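/- **Definitions.** For a ranked alphabet $\Omega$, a $k$-ary pattern over $\Omega$ is a tree over $\Omega$ whose leaves may also be labelled by the variables $x_1,\dots,x_k$, each of which occurs exactly once; we write $\mathrm{rk}(t)=k$, and $\mathrm{mr}_\Omega$ denotes the maximal rank of the symbols of a finite $\Omega$. A *multiple context-free tree grammar* (MCFTG) is $G=(N,\mathcal N,\Sigma,S,R)$, where $N$ and $\Sigma$ are disjoint finite ranked alphabets (of nonterminals and terminals) with $\mathrm{mr}_\Sigma\ge 1$; $\mathcal N$ is a finite set of nonempty repetition-free sequences over $N$ (the big nonterminals), no two distinct ones having the same set of elements; $S\in\mathcal N$ has length $1$ and rank $0$; and $R$ is a finite set of rules $A\to(u,\mathcal L)$ with $A=(A_1,\dots,A_n)\in\mathcal N$, $u=(u_1,\dots,u_n)$ a forest of patterns over $N\cup\Sigma$ with $\mathrm{rk}(u_i)=\mathrm{rk}(A_i)$ in which no nonterminal occurs more than once, and $\mathcal L\subseteq\mathcal N$ a set of big nonterminals (the links of the rule) whose element sets partition the set of nonterminals occurring in $u$. Put $\mu(G)=\max\{|A| : A\in\mathcal N\}$ and $\mathrm{wid}(G)=\mathrm{mr}_N$.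 Let the links of every rule be linearly ordered in an arbitrary fixed way, and regard $R$ as a ranked alphabet in which the rank of a rule is its number of links. A *derivation tree* of type $A$ is a tree $\rho(d_1,\dots,d_k)$ over $R$ such that $\rho$ has left-hand side $A$ and links $B_1,\dots,B_k$, and $d_i$ is a derivation tree of type $B_i$ for every $i$. Its *value* is the forest obtained from the right-hand side $u$ of $\rho$ by substituting (second-order), for each $i$, the trees of the value of $d_i$ for the corresponding nonterminals of $B_i$. The derivation trees of $G$ are those of type $S$; $L(G,A)$ is the set of values of the derivation trees of type $A$. Two MCFTGs $G,G'$ with the same $\Sigma$ are *$\mathrm{LDT}^{\mathrm R}$-equivalent* if there are value-preserving partial functions, realized by linear deterministic top-down tree transducers with regular look-ahead, from the derivation trees of $G$ to those of $G'$ (defined on all derivation trees of $G$), and vice versa. A $k$-ary pattern is *footed* if $k=0$, or it has a node of rank $k$ whose children are labelled $x_1,\dots,x_k$ from left to right; $G$ is *footed* (a non-strict multi-component tree adjoining grammar) if all trees in the right-hand sides of its rules are footed. For $\Delta\subseteq\Sigma$, $G$ is *$\Delta$-lexicalized* if a symbol of $\Delta$ occurs in the right-hand side of every rule, except possibly of those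 rules that have left-hand side $S$ and no nonterminal in the right-hand side. $G$ is *start-separated* if $S$ occurs in no right-hand side, and *reduced* if every big nonterminal $A\ne S$ is reachable from $S$ (via links of rules) and $L(G,A)\neq\emptyset$. **Theorem.** For every MCFTG $G$ with terminal alphabet $\Sigma$ and $\mathrm{wid}(G)\ge 1$ there is an $\mathrm{LDT}^{\mathrm R}$-equivalent footed MCFTG $G'$ such that $$\mu(G')\le \mu(G)\cdot \mathrm{mr}_\Sigma\cdot(2\cdot\mathrm{wid}(G)-1).$$ Moreover, for every $\Delta\subseteq\Sigma$, if $G$ is $\Delta$-lexicalized, then so is $G'$. In addition, $G'$ can be chosen reduced, and start-separated if $G$ is start-separated. -/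

import Mathlib

universe u v w

/-- The maximal rank `mr` of the symbols of a finite ranked alphabet (`0` for the empty one). -/
def maxRank {Ω : Type u} [Fintype Ω] (rk : Ω → ℕ) : ℕ :=
  Finset.univ.sup rk

/-- Trees over the ranked alphabet `(Ω, rk)` with variables from `V`, which label leaves. -/
inductive RTree {Ω : Type u} (rk : Ω → ℕ) (V : Type v) : Type (max u v)
  | var (x : V) : RTree rk V
  | node (a : Ω) (ts : Fin (rk a) → RTree rk V) : RTree rk V

/-- The set `T_Ω` of trees without variables. -/
abbrev GTree {Ω : Type u} (rk : Ω → ℕ) : Type u := RTree rk Empty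

namespace RTree

variable {Ω : Type u} {rk : Ω → ℕ}

/-- First-order substitution of trees for all the variables. -/
def bind {V : Type v} {W : Type w} (f : V → RTree rk W) : RTree rk V → RTree rk W
  | var x => f x
  | node a ts => node a (fun i => bind f (ts i))

/-- The occurrences of variables, from left to right. -/
def vars {V : Type v} : RTree rk V → List V
  | var x => [x]
  | node _ ts => (List.ofFn fun i => vars (ts i)).flatten

/-- The occurrences of symbols of `Ω`, in preorder. -/
def syms {V : Type v} : RTree rk V → List Ω
  | var _ => []
  | node a ts => a :: (List.ofFn fun i => syms (ts i)).flatten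

/-- The subtree at a position (in Dewey notation, children being numbered from `0`). -/
def subtreeAt {V : Type v} : RTree rk V → List ℕ → Option (RTree rk V)
  | t, [] => some t
  | var _, _ :: _ => none
  | node a ts, i :: p => if h : i < rk a then subtreeAt (ts ⟨i, h⟩) p else none

/-- The variables `x_1, x_2, …` are `var 0, var 1, …`; `init a` is the tree `a(x_1, …, x_k)`,
where `k` is the rank of `a`. -/
def init (a : Ω) : RTree rk ℕ :=
  node a (fun i => var i)

/-- A `k`-ary pattern: each of `x_1, …, x_k` occurs exactly once, and no other variable occurs. -/
def IsPattern (k : ℕ) (t : RTree rk ℕ) : Prop :=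
  t.vars.Perm (List.range k)

/-- A `k`-ary pattern is footed if `k = 0` or it has a node with exactly `k` children, which are
`x_1, …, x_k` in this order. -/
def Footed (k : ℕ) (t : RTree rk ℕ) : Prop :=
  k = 0 ∨ ∃ (p : List ℕ) (a : Ω), rk a = k ∧ t.subtreeAt p = some (init a)

/-- The tree homomorphism determined by `h`, which maps a symbol `a` to a tree with
variables among `x_1, …, x_{rk a}`. -/
def hom {Γ : Type w} {rk' : Γ → ℕ} (h : Ω → RTree rk' ℕ) : RTree rk ℕ → RTree rk' ℕ
  | var i => var i
  | node a ts => (h a).bind (fun i => if hi : i < rk a then hom h (ts ⟨i, hi⟩) else var i)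

end RTree

section Transducers

/-- Regular tree grammars in normal form over a finite ranked alphabet: `rule A a Bs` says that
`A → a(B_1, …, B_k)` is a rule. -/
structure RTG {Ω : Type u} [Finite Ω] (rk : Ω → ℕ) where
  NT : Type w
  finite_NT : Finite NT
  start : NT
  rule : NT → (a : Ω) → (Fin (rk a) → NT) → Prop

namespace RTG

variable {Ω : Type u} [Finite Ω] {rk : Ω → ℕ}

/-- `H.Gen A t`: the nonterminal `A` generates the tree `t`. -/
inductive Gen (H : RTG.{u, w} rk) : H.NT → GTree rk → Prop
  | node (A : H.NT) (a : Ω) (Bs : Fin (rk a) → H.NT) (ts : Fin (rk a) → GTree rk) :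
      H.rule A a Bs → (∀ i, Gen H (Bs i) (ts i)) → Gen H A (RTree.node a ts)

/-- The generated tree language. -/
def language (H : RTG.{u, w} rk) : Set (GTree rk) :=
  {t | H.Gen H.start t}

end RTG

/-- Regular tree languages. (Nonterminals form a finite set, so their universe is irrelevant.) -/
def IsRegularTreeLanguage {Ω : Type u} [Finite Ω] {rk : Ω → ℕ} (L : Set (GTree rk)) : Prop :=
  ∃ H : RTG.{u, 0} rk, H.language = L

/-- The data of a transducer rule `⟨q, a(y_1 : L_1, …, y_k : L_k) : L_0⟩ → ζ` for a fixed state `q`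
and a fixed input symbol `a` of rank `k`. The leaf `⟨q', y_i⟩` of `ζ` is the variable `(q', i)`. -/
structure LDTRRule {Ω : Type u} (rk : Ω → ℕ) {Γ : Type v} (rk' : Γ → ℕ) (Q : Type) (a : Ω) where
  look0 : Set (GTree rk)
  look : Fin (rk a) → Set (GTree rk)
  out : RTree rk' (Q × Fin (rk a))

/-- Linear deterministic top-down tree transducers with regular look-ahead. -/
structure LDTR {Ω : Type u} [Finite Ω] (rk : Ω → ℕ) {Γ : Type v} [Finite Γ] (rk' : Γ → ℕ) where
  Q : Type
  finite_Q : Finite Q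
  q0 : Q
  rules : Q → (a : Ω) → Set (LDTRRule rk rk' Q a)
  finite_rules : ∀ q a, (rules q a).Finite
  regular_look0 : ∀ q a, ∀ r ∈ rules q a, IsRegularTreeLanguage r.look0
  regular_look : ∀ q a, ∀ r ∈ rules q a, ∀ i, IsRegularTreeLanguage (r.look i)
  linear : ∀ q a, ∀ r ∈ rules q a, (r.out.vars.map Prod.snd).Nodup
  deterministic : ∀ q a, ∀ r ∈ rules q a, ∀ r' ∈ rules q a, r ≠ r' →
    Disjoint r.look0 r'.look0 ∨ ∃ i, Disjoint (r.look i) (r'.look i)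

namespace LDTR

variable {Ω : Type u} [Finite Ω] {rk : Ω → ℕ} {Γ : Type v} [Finite Γ] {rk' : Γ → ℕ}

/-- `M.Trans q s t`: the `q`-translation of `s` by `M` is defined and equals `t`. -/
inductive Trans (M : LDTR rk rk') : M.Q → GTree rk → GTree rk' → Prop
  | step (q : M.Q) (a : Ω) (ss : Fin (rk a) → GTree rk) (r : LDTRRule rk rk' M.Q a)
      (f : M.Q × Fin (rk a) → GTree rk') :
      r ∈ M.rules q a → RTree.node a ss ∈ r.look0 → (∀ i, ss i ∈ r.look i) →
      (∀ x ∈ r.out.vars, Trans M x.1 (ss x.2) (f x)) →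
      Trans M q (RTree.node a ss) (r.out.bind f)

/-- `M.Maps s t`: the tree transduction realized by `M` is defined on `s` and maps it to `t`. -/
def Maps (M : LDTR rk rk') (s : GTree rk) (t : GTree rk') : Prop :=
  M.Trans M.q0 s t

end LDTR

end Transducers

/-- Rules `A → (u, L)`: a left-hand side `A` (a sequence of nonterminals), a right-hand side `u`
(a forest over nonterminals and terminals) and a finite set `L` of links. -/
structure MCRule {N : Type u} {T : Type v} (rkN : N → ℕ) (rkT : T → ℕ) where
  lhs : List N
  rhs : List (RTree (Sum.elim rkN rkT) ℕ)
  links : Finset (List N)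

namespace MCRule

variable {N : Type u} {T : Type v} {rkN : N → ℕ} {rkT : T → ℕ}

/-- The occurrences of symbols in the right-hand side. -/
def rhsSyms (ρ : MCRule rkN rkT) : List (N ⊕ T) :=
  ρ.rhs.flatMap RTree.syms

/-- The occurrences of nonterminals in the right-hand side. -/
def rhsNonterminals (ρ : MCRule rkN rkT) : List N :=
  ρ.rhsSyms.filterMap Sum.getLeft?

/-- The requirements on a rule of a grammar with set `big` of big nonterminals. -/
structure WellFormed (big : Finset (List N)) (ρ : MCRule rkN rkT) : Prop where
  lhs_mem : ρ.lhs ∈ big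
  rank : List.Forall₂ (fun C t => RTree.IsPattern (rkN C) t) ρ.lhs ρ.rhs
  uniquely_labeled : ρ.rhsNonterminals.Nodup
  links_subset : ρ.links ⊆ big
  links_cover : ∀ C, C ∈ ρ.rhsNonterminals ↔ ∃ B ∈ ρ.links, C ∈ B
  links_disjoint : ∀ B ∈ ρ.links, ∀ B' ∈ ρ.links, ∀ C, C ∈ B → C ∈ B' → B = B'

/-- All trees of the right-hand side are footed. -/
def Footed (ρ : MCRule rkN rkT) : Prop :=
  List.Forall₂ (fun C t => RTree.Footed (rkN C) t) ρ.lhs ρ.rhs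

/-- A rule is terminal if no nonterminal occurs in its right-hand side. -/
def Terminal (ρ : MCRule rkN rkT) : Prop :=
  ρ.rhsNonterminals = []

/-- A symbol of `Δ` occurs in the right-hand side. -/
def Lexicalized (Δ : Set T) (ρ : MCRule rkN rkT) : Prop :=
  ∃ δ ∈ Δ, Sum.inr δ ∈ ρ.rhsSyms

end MCRule

/-- Multiple context-free tree grammars over the finite ranked alphabet `(T, rkT)` of terminals.
Terminals and nonterminals are disjoint because right-hand sides are trees over `N ⊕ T`.
The links of each rule come with an arbitrary linear order `linkOrder`, used for derivation trees. -/
structure MCFTG {T : Type v} [Fintype T] (rkT : T → ℕ) where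
  one_le_maxRank : 1 ≤ maxRank rkT
  N : Type u
  fintypeN : Fintype N
  rkN : N → ℕ
  big : Finset (List N)
  big_ne_nil : ∀ A ∈ big, A ≠ []
  big_nodup : ∀ A ∈ big, A.Nodup
  big_injective : ∀ A ∈ big, ∀ A' ∈ big, (∀ C, C ∈ A ↔ C ∈ A') → A = A'
  S : N
  S_mem : [S] ∈ big
  S_rank : rkN S = 0
  rules : Finset (MCRule rkN rkT)
  rules_wf : ∀ ρ ∈ rules, ρ.WellFormed big
  linkOrder : MCRule rkN rkT → List (List N)
  linkOrder_nodup : ∀ ρ ∈ rules, (linkOrder ρ).Nodup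
  mem_linkOrder : ∀ ρ ∈ rules, ∀ B, B ∈ linkOrder ρ ↔ B ∈ ρ.links

namespace MCFTG

variable {T : Type v} [Fintype T] {rkT : T → ℕ}

/-- The maximal length of the big nonterminals. -/
def multiplicity (G : MCFTG.{u, v} rkT) : ℕ :=
  G.big.sup List.length

/-- The maximal rank of the nonterminals. -/
def width (G : MCFTG.{u, v} rkT) : ℕ :=
  letI := G.fintypeN
  maxRank G.rkN

open Classical in
/-- The `i`-th tree of `t` if `B` is the `i`-th element of `C` (and an irrelevant tree if there is
no such `i`). -/
noncomputable def lookupTree {N : Type u} : List N → List (RTree rkT ℕ) → N → RTree rkT ℕ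
  | A :: C, s :: t, B => if B = A then s else lookupTree C t B
  | _, _, _ => RTree.var 0

/-- The tree homomorphism that corresponds to the second-order substitution `[C ← t]` of the trees
of `t` for the symbols of the repetition-free sequence `C`. (It is only applied to trees all of
whose nonterminals are in `C`.) -/
noncomputable def substHom {N : Type u} (C : List N) (t : List (RTree rkT ℕ)) :
    N ⊕ T → RTree rkT ℕ
  | Sum.inl B => lookupTree C t B
  | Sum.inr a => RTree.init a

/-- The forest `u[f]` for the right-hand side `u` of a rule, where the links, in their fixed
order, are `B_1, …, B_k` and `fs` lists `f(B_1), …, f(B_k)`. -/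
noncomputable def applyRule (G : MCFTG.{u, v} rkT) (ρ : MCRule G.rkN rkT)
    (fs : List (List (RTree rkT ℕ))) : List (RTree rkT ℕ) :=
  ρ.rhs.map (RTree.hom (substHom (G.linkOrder ρ).flatten fs.flatten))

/-- `G.Gen A t`: the forest `t` is in the forest language `L(G, A)`. -/
inductive Gen (G : MCFTG.{u, v} rkT) : List G.N → List (RTree rkT ℕ) → Prop
  | rule (ρ : MCRule G.rkN rkT) (f : List G.N → List (RTree rkT ℕ)) :
      ρ ∈ G.rules → (∀ B ∈ ρ.links, Gen G B (f B)) →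
      Gen G ρ.lhs (G.applyRule ρ ((G.linkOrder ρ).map f))

/-- The finite set of rules, as the ranked alphabet of derivation trees. -/
abbrev Rules (G : MCFTG.{u, v} rkT) := {ρ : MCRule G.rkN rkT // ρ ∈ G.rules}

/-- The rank of a rule: its number of links. -/
def ruleRank (G : MCFTG.{u, v} rkT) (ρ : G.Rules) : ℕ :=
  (G.linkOrder ρ.1).length

/-- The derivation tree grammar: its rules are `A → ρ(B_1, …, B_k)`, where `A` is the left-hand
side of `ρ` and `B_1, …, B_k` are its links. -/
def derGrammar (G : MCFTG.{u, v} rkT) : RTG G.ruleRank where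
  NT := {A : List G.N // A ∈ G.big}
  finite_NT := inferInstance
  start := ⟨[G.S], G.S_mem⟩
  rule A ρ Bs := ρ.1.lhs = A.1 ∧ ∀ i : Fin (G.linkOrder ρ.1).length,
    (Bs i).1 = (G.linkOrder ρ.1).get i

/-- The derivation trees of `G` (of type `S`). -/
def derTrees (G : MCFTG.{u, v} rkT) : Set (GTree G.ruleRank) :=
  G.derGrammar.language

/-- The value of a derivation tree. -/
noncomputable def val (G : MCFTG.{u, v} rkT) : GTree G.ruleRank → List (RTree rkT ℕ)
  | RTree.var e => e.elim
  | RTree.node ρ ds => G.applyRule ρ.1 (List.ofFn fun i => val G (ds i))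

/-- `LDT^R`-equivalence: there are value-preserving `LDT^R`-transductions from the derivation trees
of each grammar to those of the other. -/
def LDTREquivalent (G G' : MCFTG.{u, v} rkT) : Prop :=
  ∃ (M : LDTR G.ruleRank G'.ruleRank) (M' : LDTR G'.ruleRank G.ruleRank),
    (∀ d ∈ G.derTrees, ∃ d', M.Maps d d' ∧ d' ∈ G'.derTrees ∧ G'.val d' = G.val d) ∧
    (∀ d' ∈ G'.derTrees, ∃ d, M'.Maps d' d ∧ d ∈ G.derTrees ∧ G.val d = G'.val d')

/-- All rules are footed. -/
def Footed (G : MCFTG.{u, v} rkT) : Prop :=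
  ∀ ρ ∈ G.rules, ρ.Footed

/-- A rule is proper if it is not both initial and terminal. -/
def Proper (G : MCFTG.{u, v} rkT) (ρ : MCRule G.rkN rkT) : Prop :=
  ¬ (ρ.lhs = [G.S] ∧ ρ.Terminal)

/-- All proper rules are `Δ`-lexicalized. -/
def Lexicalized (Δ : Set T) (G : MCFTG.{u, v} rkT) : Prop :=
  ∀ ρ ∈ G.rules, G.Proper ρ → ρ.Lexicalized Δ

/-- The initial nonterminal does not occur in right-hand sides. -/
def StartSeparated (G : MCFTG.{u, v} rkT) : Prop :=
  ∀ ρ ∈ G.rules, G.S ∉ ρ.rhsNonterminals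

/-- `B'` is a link of a rule with left-hand side `B`. -/
def Step (G : MCFTG.{u, v} rkT) (B B' : List G.N) : Prop :=
  ∃ ρ ∈ G.rules, ρ.lhs = B ∧ B' ∈ ρ.links

/-- Every big nonterminal other than `S` is reachable and useful. -/
def Reduced (G : MCFTG.{u, v} rkT) : Prop :=
  ∀ A ∈ G.big, A ≠ [G.S] → Relation.ReflTransGen G.Step [G.S] A ∧ ∃ t, G.Gen A t

end MCFTG

/-!
Cut every pattern into footed pieces. Let `m` be the maximal rank of the terminals, and let `t` be
a pattern of rank `k`. Its subtrees without variables are pieces of rank `0`; in what remains, a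
maximal chain of symbols of which all but the last have exactly one argument with variables, that
argument not being a variable itself, is a piece whose foot is the last symbol of the chain
(`RTree.dec`). Such a piece is a footed pattern of rank at most `m`, and `t` is obtained by
substituting the pieces for the symbols of a tree of ranks, the shape of `t`
(`RTree.hom_fst_dec`). For `k ≥ 1` there are at most `2 * k - 1` pieces that carry variables,
whence at most `m * (2 * k - 1)` pieces in total (`RTree.length_syms_dec_le`). In particular,
there are finitely many shapes of patterns of rank `k`. The order of the variables is recorded in
the shape.

A key is a big nonterminal of `G` together with shapes for its elements. The footed grammar has
one big nonterminal for each key, with one nonterminal for each piece. A rule of `G` and keys for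
its links determine a rule of the footed grammar: substitute the shapes, viewed as trees over the
new nonterminals, for the nonterminals of the right-hand side and decompose the result. Its pieces
are the new right-hand side, and its shapes give the key of the left-hand side
(`MCFTG.Inst.toRule`, `MCFTG.Inst.head`). The decomposition does not distinguish nonterminals from
terminals: the value of a nonterminal is footed of the same rank, and so substituting it in a
footed piece yields a footed pattern again. By associativity of second-order substitution, the
value of a derivation tree of `G` is obtained from the shapes of its key by substituting the value
of the corresponding derivation tree of the footed grammar (`MCFTG.Inst.applyRule_eq`,
`MCFTG.Inst.val_eq`).

A pattern of rank `1` that is a variable has no pieces. Keys without pieces are not big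
nonterminals, and links with such keys are omitted. The rule symbols of derivation trees of `G`
are relabelled with look-ahead for the keys, which are computed by a finite tree automaton;
subtrees whose keys have no pieces are deleted (`MCFTG.toFooted`). Conversely, the rule symbols
are replaced by rules of `G` from which they arise, and for each omitted link a fixed derivation
tree is inserted (`MCFTG.ofFooted`). The pieces contain the same terminals as the right-hand side
that they are cut from, so that lexicalization is preserved. The footed grammar is reduced because
only keys are admitted that are reachable from the key of the initial nonterminal through keys of
actual derivation trees.
-/

/-! ### Trees: substitution, relabelling and tree homomorphisms -/

theorem List.coe_flatten_ofFn {α : Type u} {n : ℕ} (l : Fin n → List α) :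
    ((List.ofFn l).flatten : Multiset α) = ∑ i, (l i : Multiset α) := by
  rw [← List.sum_ofFn]
  generalize hL : List.ofFn l = L
  have : (List.ofFn fun i => (l i : Multiset α)) = L.map Multiset.ofList := by
    rw [← hL, List.map_ofFn]; rfl
  rw [this]
  clear hL this
  induction L with
  | nil => rfl
  | cons x L ih => rw [List.map_cons, List.sum_cons, ← ih]; rfl

theorem List.coe_flatMap {α : Type u} {β : Type v} (l : List α) (f : α → List β) :
    (l.flatMap f : Multiset β) = (l.map fun a => (f a : Multiset β)).sum := by
  induction l with
  | nil => rfl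
  | cons x L ih => simp [← ih]

theorem List.sum_map_flatten_ofFn {α : Type u} {M : Type v} [AddCommMonoid M] {n : ℕ}
    (l : Fin n → List α) (f : α → M) :
    ((List.ofFn l).flatten.map f).sum = ∑ i, ((l i).map f).sum := by
  rw [List.map_flatten, List.sum_flatten, List.map_map, List.map_ofFn, List.sum_ofFn]
  rfl

theorem List.mem_flatten_ofFn {α : Type u} {n : ℕ} (l : Fin n → List α) (a : α) :
    a ∈ (List.ofFn l).flatten ↔ ∃ i, a ∈ l i := by
  simp [List.mem_flatten, List.mem_ofFn]

theorem List.forall₂_ofFn {α : Type u} {β : Type v} {R : α → β → Prop} {n : ℕ}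
    {f : Fin n → α} {g : Fin n → β} (h : ∀ i, R (f i) (g i)) :
    List.Forall₂ R (List.ofFn f) (List.ofFn g) := by
  rw [List.forall₂_iff_get]
  refine ⟨by simp, fun i h1 h2 => ?_⟩
  simpa using h ⟨i, by simpa using h1⟩

namespace RTree

section

variable {Ω : Type u} {rk : Ω → ℕ} {V : Type v}

theorem mem_vars_node {a : Ω} {ts : Fin (rk a) → RTree rk V} {x : V} :
    x ∈ (node a ts).vars ↔ ∃ i, x ∈ (ts i).vars := by
  rw [vars, List.mem_flatten_ofFn]

theorem vars_node_eq_nil {a : Ω} {ts : Fin (rk a) → RTree rk V} :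
    (node a ts).vars = [] ↔ ∀ i, (ts i).vars = [] := by
  simp only [List.eq_nil_iff_forall_not_mem, mem_vars_node, not_exists]
  exact ⟨fun h i x => h x i, fun h x i => h i x⟩

theorem mem_syms_node {a : Ω} {ts : Fin (rk a) → RTree rk V} {b : Ω} :
    b ∈ (node a ts).syms ↔ b = a ∨ ∃ i, b ∈ (ts i).syms := by
  rw [syms, List.mem_cons, List.mem_flatten_ofFn]

theorem vars_bind {W : Type w} (f : V → RTree rk W) (t : RTree rk V) :
    (t.bind f).vars = t.vars.flatMap fun x => (f x).vars := by
  induction t with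
  | var x => simp [bind, vars]
  | node a ts ih =>
    simp only [bind, vars, ih, List.flatMap_def, List.map_flatten, List.map_ofFn]
    rw [List.flatten_flatten, List.map_ofFn]
    rfl

theorem bind_congr {W : Type w} {f g : V → RTree rk W} (t : RTree rk V)
    (h : ∀ x ∈ t.vars, f x = g x) : t.bind f = t.bind g := by
  induction t with
  | var x => exact h x (by simp [vars])
  | node a ts ih =>
    simp only [bind]
    congr 1
    funext i
    exact ih i fun x hx => h x (mem_vars_node.2 ⟨i, hx⟩)

theorem bind_var (t : RTree rk V) : t.bind var = t := by
  induction t with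
  | var x => rfl
  | node a ts ih => simp only [bind, ih]

theorem bind_of_vars_eq_nil (f : V → RTree rk V) {t : RTree rk V} (h : t.vars = []) :
    t.bind f = t := by
  rw [bind_congr (g := var) t (by simp [h]), bind_var]

theorem bind_bind {W : Type w} {W' : Type*} (f : V → RTree rk W) (g : W → RTree rk W')
    (t : RTree rk V) : (t.bind f).bind g = t.bind fun x => (f x).bind g := by
  induction t with
  | var x => rfl
  | node a ts ih => simp only [bind, ih]

theorem coe_syms_node (a : Ω) (ts : Fin (rk a) → RTree rk V) :
    ((node a ts).syms : Multiset Ω) = {a} + ∑ i, ((ts i).syms : Multiset Ω) := by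
  rw [syms, ← List.coe_flatten_ofFn, ← Multiset.coe_singleton, Multiset.coe_add]; rfl

theorem coe_syms_bind {W : Type w} (f : V → RTree rk W) (t : RTree rk V) :
    ((t.bind f).syms : Multiset Ω) =
      t.syms + (t.vars.map fun x => ((f x).syms : Multiset Ω)).sum := by
  induction t with
  | var x => simp [bind, syms, vars]
  | node a ts ih =>
    rw [bind, coe_syms_node, coe_syms_node, vars, List.sum_map_flatten_ofFn, add_assoc,
      ← Finset.sum_add_distrib]
    simp only [ih]

theorem isPattern_iff {k : ℕ} {t : RTree rk ℕ} :
    IsPattern k t ↔ (t.vars : Multiset ℕ) = Multiset.range k :=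
  Multiset.coe_eq_coe.symm

theorem IsPattern.lt {k : ℕ} {t : RTree rk ℕ} (h : IsPattern k t) {x : ℕ} (hx : x ∈ t.vars) :
    x < k := List.mem_range.1 (List.Perm.mem_iff h |>.1 hx)

theorem vars_init (a : Ω) : (init (rk := rk) a).vars = List.range (rk a) := by
  simp only [init, vars]
  rw [← List.map_coe_finRange_eq_range, List.ofFn_eq_map, ← List.flatMap_def]
  exact List.map_eq_flatMap.symm

theorem isPattern_init (a : Ω) : IsPattern (rk a) (init (rk := rk) a) := by
  rw [IsPattern, vars_init]

theorem syms_init (a : Ω) : (init (rk := rk) a).syms = [a] := by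
  simp [init, syms]

/-- Renaming of symbols by a rank-preserving map, where rank preservation is definitional. -/
def relabel {Ω' : Type w} {rk' : Ω' → ℕ} (φ : Ω → Ω') :
    RTree (fun a => rk' (φ a)) V → RTree rk' V
  | var x => var x
  | node a ts => node (φ a) fun i => relabel φ (ts i)

end

section

variable {Ω : Type u} {V : Type v} {Ω' : Type w} {rk' : Ω' → ℕ} (φ : Ω → Ω')

theorem vars_relabel (t : RTree (fun a => rk' (φ a)) V) :
    (relabel (rk' := rk') φ t).vars = t.vars := by
  induction t with
  | var x => rfl
  | node a ts ih => simp only [relabel, vars, ih]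

theorem syms_relabel (t : RTree (fun a => rk' (φ a)) V) :
    (relabel (rk' := rk') φ t).syms = t.syms.map φ := by
  induction t with
  | var x => rfl
  | node a ts ih =>
    simp only [relabel, syms, ih, List.map_cons, List.map_flatten, List.map_ofFn]
    rfl

theorem hom_relabel {Γ : Type*} {rkΓ : Γ → ℕ} (h : Ω' → RTree rkΓ ℕ)
    (t : RTree (fun a => rk' (φ a)) ℕ) :
    hom h (relabel (rk' := rk') φ t) = hom (fun a => h (φ a)) t := by
  induction t with
  | var x => rfl
  | node a ts ih => simp only [relabel, hom, ih]

end

section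

variable {Ω : Type u} {rk : Ω → ℕ} {Γ : Type v} {rk' : Γ → ℕ}

theorem hom_congr {h h' : Ω → RTree rk' ℕ} (t : RTree rk ℕ) (H : ∀ a ∈ t.syms, h a = h' a) :
    hom h t = hom h' t := by
  induction t with
  | var x => rfl
  | node a ts ih =>
    simp only [hom]
    rw [H a (mem_syms_node.2 (Or.inl rfl))]
    congr 1
    funext i
    split_ifs with hi
    · exact ih _ fun b hb => H b (mem_syms_node.2 (Or.inr ⟨_, hb⟩))
    · rfl

/-- A tree homomorphism commutes with first-order substitution. A variable of `h a` beyond the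
rank of `a` would be captured by the substitution, whence the hypothesis. -/
theorem hom_bind (h : Ω → RTree rk' ℕ) (g : ℕ → RTree rk ℕ) (t : RTree rk ℕ)
    (H : ∀ a ∈ t.syms, ∀ x ∈ (h a).vars, x < rk a) :
    hom h (t.bind g) = (hom h t).bind fun i => hom h (g i) := by
  induction t with
  | var x => rfl
  | node a ts ih =>
    simp only [bind, hom]
    rw [bind_bind]
    refine bind_congr _ fun x hx => ?_
    have hxa := H a (mem_syms_node.2 (Or.inl rfl)) x hx
    rw [dif_pos hxa, dif_pos hxa]
    exact ih _ fun b hb => H b (mem_syms_node.2 (Or.inr ⟨_, hb⟩))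

theorem hom_hom {Λ : Type w} {rk'' : Λ → ℕ} (h : Ω → RTree rk' ℕ) (h' : Γ → RTree rk'' ℕ)
    (t : RTree rk ℕ) (H : ∀ a ∈ t.syms, ∀ b ∈ (h a).syms, ∀ x ∈ (h' b).vars, x < rk' b) :
    hom h' (hom h t) = hom (fun a => hom h' (h a)) t := by
  induction t with
  | var x => rfl
  | node a ts ih =>
    simp only [hom]
    rw [hom_bind _ _ _ (H a (mem_syms_node.2 (Or.inl rfl)))]
    congr 1
    funext i
    split_ifs with hi
    · exact ih _ fun b hb => H b (mem_syms_node.2 (Or.inr ⟨_, hb⟩))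
    · rfl

theorem sum_range_dite {M : Type*} [AddCommMonoid M] {n : ℕ} (F : Fin n → M) (z : ℕ → M) :
    ((Multiset.range n).map fun i => if hi : i < n then F ⟨i, hi⟩ else z i).sum = ∑ i, F i := by
  have := Finset.sum_range (fun i => if hi : i < n then F ⟨i, hi⟩ else z i) (n := n)
  simp only [Fin.is_lt, dite_true, Fin.eta] at this
  exact this

/-- Only the multisets agree, because a pattern may contain its variables in any order. -/
theorem coe_vars_hom (h : Ω → RTree rk' ℕ) (t : RTree rk ℕ)
    (H : ∀ a ∈ t.syms, IsPattern (rk a) (h a)) :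
    ((hom h t).vars : Multiset ℕ) = t.vars := by
  induction t with
  | var x => rfl
  | node a ts ih =>
    have ha := isPattern_iff.1 (H a (mem_syms_node.2 (Or.inl rfl)))
    rw [hom, vars_bind, List.coe_flatMap, ← Multiset.sum_coe, ← Multiset.map_coe, ha, vars,
      List.coe_flatten_ofFn, ← sum_range_dite _ (fun i => ((var i : RTree rk ℕ).vars : Multiset ℕ))]
    congr 1
    refine Multiset.map_congr rfl fun i _ => ?_
    split_ifs with hi
    · exact ih _ fun b hb => H b (mem_syms_node.2 (Or.inr ⟨_, hb⟩))
    · rfl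

theorem IsPattern.hom {h : Ω → RTree rk' ℕ} {t : RTree rk ℕ} {k : ℕ} (ht : IsPattern k t)
    (H : ∀ a ∈ t.syms, IsPattern (rk a) (h a)) : IsPattern k (hom h t) := by
  rw [isPattern_iff, coe_vars_hom h t H, ← isPattern_iff]
  exact ht

theorem coe_syms_hom (h : Ω → RTree rk' ℕ) (t : RTree rk ℕ)
    (H : ∀ a ∈ t.syms, IsPattern (rk a) (h a)) :
    ((hom h t).syms : Multiset Γ) = (t.syms.map fun a => ((h a).syms : Multiset Γ)).sum := by
  induction t with
  | var x => rfl
  | node a ts ih =>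
    have ha := isPattern_iff.1 (H a (mem_syms_node.2 (Or.inl rfl)))
    rw [hom, coe_syms_bind, ← Multiset.sum_coe, ← Multiset.map_coe, ha, syms, List.map_cons,
      List.sum_cons, List.sum_map_flatten_ofFn, ← sum_range_dite _ (fun _ => (0 : Multiset Γ))]
    congr 2
    refine Multiset.map_congr rfl fun i _ => ?_
    split_ifs with hi
    · exact ih _ fun b hb => H b (mem_syms_node.2 (Or.inr ⟨_, hb⟩))
    · rfl

end

end RTree

/-! ### Addresses -/

namespace RTree

section

variable {Ω : Type u} {rk : Ω → ℕ} {V : Type v}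

/-- The tree with each symbol paired with its Dewey address, prefixed by `p`. -/
def addr (p : List ℕ) : RTree rk V → RTree (fun x : Ω × List ℕ => rk x.1) V
  | var x => var x
  | node a ts => node (a, p) fun i => addr (p ++ [(i : ℕ)]) (ts i)

theorem map_fst_syms_addr (p : List ℕ) (t : RTree rk V) :
    (addr p t).syms.map Prod.fst = t.syms := by
  induction t generalizing p with
  | var x => rfl
  | node a ts ih =>
    simp only [addr, syms, List.map_cons, List.map_flatten, List.map_ofFn, Function.comp_def, ih]

theorem prefix_of_mem_syms_addr (p : List ℕ) (t : RTree rk V) :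
    ∀ x ∈ (addr p t).syms, p <+: x.2 := by
  induction t generalizing p with
  | var x => simp [addr, syms]
  | node a ts ih =>
    intro x hx
    rw [addr, mem_syms_node] at hx
    rcases hx with rfl | ⟨i, hi⟩
    · exact List.prefix_rfl
    · exact (List.prefix_append _ _).trans (ih i _ x hi)

theorem eq_of_snoc_prefix {p q : List ℕ} {i j : ℕ} (hi : p ++ [i] <+: q)
    (hj : p ++ [j] <+: q) : i = j := by
  obtain ⟨r, rfl⟩ := hi
  obtain ⟨s, hs⟩ := hj
  simp only [List.append_assoc, List.append_cancel_left_eq, List.cons_append,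
    List.cons.injEq] at hs
  exact hs.1.symm

theorem nodup_addr (p : List ℕ) (t : RTree rk V) : ((addr p t).syms.map Prod.snd).Nodup := by
  induction t generalizing p with
  | var x => simp [addr, syms]
  | node a ts ih =>
    simp only [addr, syms, List.map_cons, List.map_flatten, List.map_ofFn, List.nodup_cons]
    constructor
    · rw [List.mem_flatten_ofFn]
      rintro ⟨i, hi⟩
      obtain ⟨x, hx, hxp⟩ := List.mem_map.1 hi
      have := (prefix_of_mem_syms_addr _ _ x hx).length_le
      simp [hxp] at this
    · rw [List.nodup_flatten]
      refine ⟨?_, ?_⟩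
      · intro l hl
        obtain ⟨i, rfl⟩ := List.mem_ofFn.1 hl
        exact ih i _
      · rw [List.pairwise_ofFn]
        intro i j hij q hi hj
        obtain ⟨x, hx, rfl⟩ := List.mem_map.1 hi
        obtain ⟨y, hy, hyx⟩ := List.mem_map.1 hj
        have h1 := prefix_of_mem_syms_addr _ _ x hx
        have h2 := prefix_of_mem_syms_addr _ _ y hy
        rw [hyx] at h2
        exact hij.ne (Fin.ext (eq_of_snoc_prefix h1 h2))

theorem relabel_fst_addr (p : List ℕ) (t : RTree rk V) :
    relabel (rk' := rk) Prod.fst (addr p t) = t := by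
  induction t generalizing p with
  | var x => rfl
  | node a ts ih => simp only [addr, relabel, ih]

end

theorem addr_relabel {Ω : Type u} {V : Type v} {Ω' : Type w} {rk' : Ω' → ℕ} (φ : Ω → Ω')
    (p : List ℕ) (t : RTree (fun a => rk' (φ a)) V) :
    addr p (relabel (rk' := rk') φ t) =
      relabel (rk' := fun x : Ω' × List ℕ => rk' x.1) (fun x : Ω × List ℕ => (φ x.1, x.2))
        (addr p t) := by
  induction t generalizing p with
  | var x => rfl
  | node a ts ih => simp only [addr, relabel, ih]

section

variable {Ω : Type u} {rk : Ω → ℕ} {V : Type v}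

/-- The trees of a forest with addresses whose first entry is the index of the tree. -/
def addrForest (ts : List (RTree rk V)) : List (RTree (fun x : Ω × List ℕ => rk x.1) V) :=
  ts.zipIdx.map fun x => addr [x.2] x.1

theorem nodup_addrForest (ts : List (RTree rk V)) :
    (((addrForest ts).flatMap syms).map Prod.snd).Nodup := by
  rw [addrForest, List.flatMap_map, List.map_flatMap, List.nodup_flatMap]
  refine ⟨fun x _ => nodup_addr _ _, ?_⟩
  have h : (ts.zipIdx.map Prod.snd).Nodup := by
    rw [List.zipIdx_map_snd]; exact List.nodup_range'
  rw [List.Nodup, List.pairwise_map] at h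
  refine h.imp fun {a b} hab q hi hj => ?_
  obtain ⟨x, hx, rfl⟩ := List.mem_map.1 hi
  obtain ⟨y, hy, hyx⟩ := List.mem_map.1 hj
  have h1 := prefix_of_mem_syms_addr _ _ x hx
  have h2 := prefix_of_mem_syms_addr _ _ y hy
  rw [hyx] at h2
  exact hab (eq_of_snoc_prefix (p := []) h1 h2)

theorem length_addrForest_syms (ts : List (RTree rk V)) :
    ((addrForest ts).flatMap syms).length = (ts.map fun t => t.syms.length).sum := by
  rw [addrForest, List.flatMap_map, List.length_flatMap]
  have h : ∀ x : RTree rk V × ℕ, (addr [x.2] x.1).syms.length = x.1.syms.length := fun x => by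
    rw [← map_fst_syms_addr [x.2] x.1, List.length_map]
  simp only [h]
  rw [show (fun x : RTree rk V × ℕ => x.1.syms.length) = (fun t => t.syms.length) ∘ Prod.fst from
    rfl, ← List.map_map, List.zipIdx_map_fst]

theorem map_relabel_fst_addrForest (ts : List (RTree rk V)) :
    (addrForest ts).map (relabel (rk' := rk) Prod.fst) = ts := by
  rw [addrForest, List.map_map]
  simp only [Function.comp_def, relabel_fst_addr]
  exact List.zipIdx_map_fst _ _

end

theorem addrForest_map_relabel {Ω : Type u} {V : Type v} {Ω' : Type w} {rk' : Ω' → ℕ} (φ : Ω → Ω')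
    (ts : List (RTree (fun a => rk' (φ a)) V)) :
    addrForest (ts.map (relabel (rk' := rk') φ)) =
      (addrForest ts).map (relabel (rk' := fun x : Ω' × List ℕ => rk' x.1)
        (fun x : Ω × List ℕ => (φ x.1, x.2))) := by
  simp only [addrForest, List.zipIdx_map, List.map_map, Function.comp_def, Prod.map, addr_relabel]
  rfl

/-! ### Decomposition of a tree into footed patterns -/

section

variable {Ω : Type u} {rk : Ω → ℕ} {m : ℕ}

/-- Trees whose symbols are pieces, i.e., trees over `(Ω, rk)` together with a rank. -/
abbrev PieceTree (rk : Ω → ℕ) (m : ℕ) : Type u :=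
  RTree (fun x : RTree rk ℕ × Fin (m + 1) => (x.2 : ℕ)) ℕ

open Classical in
/-- The decomposition of a tree into footed pieces, arranged in a tree. A subtree without variables
is a piece of rank `0`; a symbol with a single argument `t` that has variables is added on top of
the topmost piece of `t`, unless `t` is a variable; every other symbol starts a new piece. -/
noncomputable def dec (hm : ∀ a, rk a ≤ m) : RTree rk ℕ → PieceTree rk m
  | var x => var x
  | node a ts =>
    if (node a ts).vars = [] then node (node a ts, ⟨0, m.succ_pos⟩) fun _ => var 0
    else if h : ∃ j, ∀ i ≠ j, (ts i).vars = [] then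
      match dec hm (ts h.choose) with
      | var _ => node (init a, ⟨rk a, Nat.lt_succ_of_le (hm a)⟩) fun i => dec hm (ts i)
      | node (p, r) cs => node (node a (Function.update ts h.choose p), r) cs
    else node (init a, ⟨rk a, Nat.lt_succ_of_le (hm a)⟩) fun i => dec hm (ts i)

/-- Induction along the four cases of `dec`. -/
theorem dec_induction (hm : ∀ a, rk a ≤ m) {motive : RTree rk ℕ → PieceTree rk m → Prop}
    (hvar : ∀ x, motive (var x) (var x))
    (hclosed : ∀ a ts cs, (node a ts).vars = [] →
      motive (node a ts) (node (node a ts, ⟨0, m.succ_pos⟩) cs))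
    (hextend : ∀ a ts j p r cs, (∀ i ≠ j, (ts i).vars = []) → motive (ts j) (node (p, r) cs) →
      (ts j).vars ≠ [] → motive (node a ts) (node (node a (Function.update ts j p), r) cs))
    (hbranch : ∀ a ts (Ds : Fin (rk a) → PieceTree rk m), (node a ts).vars ≠ [] →
      (∀ i, motive (ts i) (Ds i)) →
      (∀ j, (∀ i ≠ j, (ts i).vars = []) → ∃ x, Ds j = var x) →
      motive (node a ts) (node (init a, ⟨rk a, Nat.lt_succ_of_le (hm a)⟩) Ds)) (t : RTree rk ℕ) :
    motive t (dec hm t) := by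
  classical
  induction t with
  | var x => exact hvar x
  | node a ts ih =>
    rw [dec]
    split_ifs with h0 h
    · exact hclosed a ts _ h0
    · have hne : (ts h.choose).vars ≠ [] := fun hc => h0 <| vars_node_eq_nil.2 fun i => by
        by_cases hi : i = h.choose
        · rw [hi, hc]
        · exact h.choose_spec i hi
      have ihj := ih h.choose
      split
      · next x hx =>
        refine hbranch a ts _ h0 ih fun j hj => ?_
        by_cases hjc : j = h.choose
        · exact ⟨x, by rw [hjc, hx]⟩
        · exact absurd (hj _ (Ne.symm hjc)) hne
      · next p r cs hx =>
        rw [hx] at ihj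
        exact hextend a ts h.choose p r cs h.choose_spec ihj hne
    · exact hbranch a ts _ h0 ih fun j hj => (h ⟨j, hj⟩).elim

/-- Substituting the pieces for themselves gives back the tree. -/
theorem hom_fst_dec (hm : ∀ a, rk a ≤ m) (t : RTree rk ℕ) : hom Prod.fst (dec hm t) = t := by
  refine dec_induction hm (motive := fun t D => hom Prod.fst D = t) (fun x => rfl) ?_ ?_ ?_ t
  · intro a ts cs h
    exact bind_of_vars_eq_nil _ h
  · intro a ts j p r cs hj ih _
    simp only [hom, bind] at ih ⊢
    congr 1
    funext i
    by_cases hi : i = j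
    · subst hi
      rw [Function.update_self, ih]
    · rw [Function.update_of_ne hi, bind_of_vars_eq_nil _ (hj i hi)]
  · intro a ts Ds _ ih _
    simp only [hom, bind, init]
    congr 1
    funext i
    rw [dif_pos i.2]
    exact ih i

/-- The pieces are footed patterns. -/
theorem isPattern_footed_of_mem_syms_dec (hm : ∀ a, rk a ≤ m) (t : RTree rk ℕ) :
    ∀ x ∈ (dec hm t).syms, IsPattern (x.2 : ℕ) x.1 ∧ Footed (x.2 : ℕ) x.1 := by
  refine dec_induction hm (motive := fun _ D => ∀ x ∈ D.syms,
    IsPattern (x.2 : ℕ) x.1 ∧ Footed (x.2 : ℕ) x.1) ?_ ?_ ?_ ?_ t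
  · simp [syms]
  · intro a ts cs h x hx
    rw [mem_syms_node] at hx
    rcases hx with rfl | ⟨i, _⟩
    · exact ⟨by simp [IsPattern, h], Or.inl rfl⟩
    · exact i.elim0
  · intro a ts j p r cs hj ih _ x hx
    rw [mem_syms_node] at hx
    rcases hx with rfl | ⟨i, hi⟩
    · obtain ⟨h1, h2⟩ := ih _ (mem_syms_node.2 (Or.inl rfl))
      constructor
      · rw [isPattern_iff] at h1 ⊢
        rw [vars, List.coe_flatten_ofFn, Finset.sum_eq_single j, Function.update_self, h1]
        · intro i _ hi
          rw [Function.update_of_ne hi, hj i hi]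
          rfl
        · simp
      · refine h2.imp id ?_
        rintro ⟨q, b, hb, hq⟩
        refine ⟨j :: q, b, hb, ?_⟩
        rw [subtreeAt, dif_pos j.2]
        simpa using hq
    · exact ih x (mem_syms_node.2 (Or.inr ⟨i, hi⟩))
  · intro a ts Ds _ ih _ x hx
    rw [mem_syms_node] at hx
    rcases hx with rfl | ⟨i, hi⟩
    · exact ⟨isPattern_init a, Or.inr ⟨[], a, rfl, by simp [subtreeAt]⟩⟩
    · exact ih i x hi

/-- The bound on the number of pieces of a `k`-ary pattern over symbols of rank at most `m`. -/
def pieceBound (m k : ℕ) : ℕ := if k = 0 then 1 else m * (2 * k - 1)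

/-- The bound is linear in `k` up to a correction for `k ≠ 0`, which makes it easy to sum. -/
theorem pieceBound_add (m k : ℕ) :
    pieceBound m k + (m + 1) * (if k = 0 then 0 else 1) = 1 + 2 * m * k := by
  rcases k with _ | k
  · simp [pieceBound]
  · simp only [pieceBound, Nat.succ_ne_zero, if_false]
    rw [show 2 * (k + 1) - 1 = 2 * k + 1 by omega]
    ring

theorem length_syms_node (a : Ω) {V : Type v} (ts : Fin (rk a) → RTree rk V) :
    (node a ts).syms.length = 1 + ∑ i, (ts i).syms.length := by
  have := congrArg Multiset.card (coe_syms_node a ts)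
  simpa [add_comm] using this

theorem length_vars_node (a : Ω) {V : Type v} (ts : Fin (rk a) → RTree rk V) :
    (node a ts).vars.length = ∑ i, (ts i).vars.length := by
  have := congrArg Multiset.card (List.coe_flatten_ofFn fun i => (ts i).vars)
  simpa [vars] using this

/-- A piece that carries several variables is followed by at least two branches that carry
variables, so that there are at most `2 * k - 1` maximal chains of pieces that do; each of them
contributes one piece that carries variables and fewer than `m` pieces of rank `0`. -/
theorem length_syms_dec_le (hm : ∀ a, rk a ≤ m) (t : RTree rk ℕ) :
    (dec hm t).syms.length ≤ pieceBound m t.vars.length := by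
  refine dec_induction hm (motive := fun t D => D.syms.length ≤ pieceBound m t.vars.length)
    ?_ ?_ ?_ ?_ t
  · simp [syms]
  · intro a ts cs h
    rw [length_syms_node, h]
    have : ∀ f : Fin 0 → ℕ, ∑ i, f i = 0 := fun f => by simp
    exact (congrArg (1 + ·) (this _)).le
  · intro a ts j p r cs hj ih _
    rw [length_syms_node] at ih ⊢
    rw [length_vars_node, Finset.sum_eq_single j (fun i _ hi => by rw [hj i hi]; rfl) (by simp)]
    exact ih
  · intro a ts Ds hne ih hbr
    have hpos : (node a ts).vars.length ≠ 0 := fun h => hne (List.length_eq_zero_iff.1 h)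
    have hk := hpos
    rw [length_syms_node]
    have hra := hm a
    change 1 + ∑ i : Fin (rk a), (Ds i).syms.length ≤ _
    by_cases h : ∃ j, ∀ i ≠ j, (ts i).vars = []
    -- The only argument with variables is a variable; each other argument is a single piece.
    · obtain ⟨j, hj⟩ := h
      obtain ⟨x, hx⟩ := hbr j hj
      have h1 : ∑ i, (Ds i).syms.length ≤ ∑ i, if i = j then 0 else 1 := by
        refine Finset.sum_le_sum fun i _ => ?_
        split_ifs with hi
        · rw [hi, hx]; simp [syms]
        · have := ih i
          rw [hj i hi] at this
          exact this
      have h2 : (∑ i : Fin (rk a), if i = j then 0 else 1) + 1 = rk a := by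
        have : (∑ i : Fin (rk a), if i = j then 0 else 1) +
            (∑ i : Fin (rk a), if i = j then 1 else 0) = rk a := by
          rw [← Finset.sum_add_distrib]
          trans ∑ i : Fin (rk a), 1
          · exact Finset.sum_congr rfl fun i _ => by split_ifs <;> rfl
          · simp
        simpa using this
      have h3 : m ≤ pieceBound m (node a ts).vars.length := by
        rw [pieceBound, if_neg hpos]
        exact Nat.le_mul_of_pos_right _ (by omega)
      omega
    -- At least two arguments have variables. Each of them lowers the sum of the bounds by `m + 1`,
    -- as compared with the linear function of `pieceBound_add`.
    · push Not at h
      obtain ⟨j, hj⟩ : ∃ j, (ts j).vars ≠ [] := by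
        by_contra hc
        push Not at hc
        exact hne (vars_node_eq_nil.2 hc)
      obtain ⟨i, hij, hi⟩ := h j
      have hc : 2 ≤ ∑ i, if (ts i).vars.length = 0 then 0 else 1 := by
        have h4 : ∑ l ∈ {i, j}, (if (ts l).vars.length = 0 then 0 else 1) ≤
            ∑ l, if (ts l).vars.length = 0 then 0 else 1 :=
          Finset.sum_le_sum_of_subset (Finset.subset_univ _)
        rw [Finset.sum_pair hij, if_neg (by simpa using hi), if_neg (by simpa using hj)] at h4
        exact h4
      have hs : ∑ i, (Ds i).syms.length ≤ ∑ i, pieceBound m (ts i).vars.length :=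
        Finset.sum_le_sum fun i _ => ih i
      have he : ∑ i, pieceBound m (ts i).vars.length +
          (m + 1) * (∑ i, if (ts i).vars.length = 0 then 0 else 1) =
          rk a + 2 * m * (node a ts).vars.length := by
        rw [length_vars_node, Finset.mul_sum, Finset.mul_sum, ← Finset.sum_add_distrib]
        simp only [pieceBound_add]
        rw [Finset.sum_add_distrib]
        simp
      have hb := pieceBound_add m (node a ts).vars.length
      rw [if_neg hpos] at hb
      have := Nat.mul_le_mul_left (m + 1) hc
      omega

end

end RTree

/-! ### Shapes -/

/-- The shape of a decomposed tree: the tree of the ranks of its pieces. -/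
abbrev Shape (m : ℕ) : Type := RTree (fun r : Fin (m + 1) => (r : ℕ)) ℕ

/-- The properties of the shapes of decomposed `k`-ary patterns that bound their number. -/
structure GoodShape (m k : ℕ) (s : Shape m) : Prop where
  isPattern : s.IsPattern k
  length_le : s.syms.length ≤ RTree.pieceBound m k

open RTree in
theorem finite_setOf_shape (m n k : ℕ) :
    {s : Shape m | s.syms.length ≤ n ∧ ∀ x ∈ s.vars, x < k}.Finite := by
  induction n with
  | zero =>
    refine ((Set.finite_Iio k).image (var : ℕ → Shape m)).subset ?_
    rintro (x | ⟨a, ts⟩) ⟨h1, h2⟩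
    · exact ⟨x, h2 x (by simp [vars]), rfl⟩
    · simp [syms] at h1
  | succ n ih =>
    refine (((Set.finite_Iio k).image (var : ℕ → Shape m)).union
      (Set.finite_iUnion fun r : Fin (m + 1) =>
        (Set.Finite.pi' fun _ : Fin (r : ℕ) => ih).image (node r))).subset ?_
    rintro (x | ⟨a, ts⟩) ⟨h1, h2⟩
    · exact Or.inl ⟨x, h2 x (by simp [vars]), rfl⟩
    · refine Or.inr (Set.mem_iUnion.2 ⟨a, ts, fun i => ⟨?_, fun x hx => ?_⟩, rfl⟩)
      · rw [length_syms_node] at h1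
        have := Finset.single_le_sum (f := fun i => (ts i).syms.length) (by simp)
          (Finset.mem_univ i)
        omega
      · exact h2 x (mem_vars_node.2 ⟨i, hx⟩)

theorem finite_setOf_goodShape (m k : ℕ) : {s : Shape m | GoodShape m k s}.Finite :=
  (finite_setOf_shape m (RTree.pieceBound m k) k).subset fun _ hs =>
    ⟨hs.length_le, fun _ hx => hs.isPattern.lt hx⟩

theorem Set.Finite.setOf_forall₂ {α : Type u} {β : Type v} {R : α → β → Prop}
    (h : ∀ a, {b | R a b}.Finite) (l : List α) : {l' | List.Forall₂ R l l'}.Finite := by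
  induction l with
  | nil => simp
  | cons a l ih =>
    refine (Set.Finite.image2 List.cons (h a) ih).subset ?_
    intro l' hl'
    obtain ⟨b, l'', h1, h2, rfl⟩ := List.forall₂_cons_left_iff.1 hl'
    exact ⟨b, h1, l'', h2, rfl⟩

theorem le_maxRank {Ω : Type u} [Fintype Ω] (rk : Ω → ℕ) (a : Ω) : rk a ≤ maxRank rk :=
  Finset.le_sup (f := rk) (Finset.mem_univ a)

/-- A pattern of rank `0` is a single piece. -/
theorem GoodShape.eq_node {m : ℕ} {s : Shape m} (h : GoodShape m 0 s) :
    s = RTree.node ⟨0, m.succ_pos⟩ fun i => i.elim0 := by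
  have hv : s.vars = [] := List.perm_nil.1 h.isPattern
  have hl := h.length_le
  rcases s with x | ⟨r, ts⟩
  · simp [RTree.vars] at hv
  · rw [RTree.length_syms_node] at hl
    have hr : (r : ℕ) = 0 := by
      by_contra hr
      have i : Fin (r : ℕ) := ⟨0, Nat.pos_of_ne_zero hr⟩
      have h0 : (ts i).syms.length = 0 := by
        have := Finset.single_le_sum (f := fun i => (ts i).syms.length) (by simp)
          (Finset.mem_univ i)
        simp only [RTree.pieceBound, if_true] at this hl
        omega
      have hvi := RTree.vars_node_eq_nil.1 hv i
      cases hti : ts i with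
      | var x => simp [hti, RTree.vars] at hvi
      | node b us => simp [hti, RTree.syms] at h0
    obtain rfl : r = ⟨0, m.succ_pos⟩ := Fin.ext hr
    congr 1
    funext i
    exact i.elim0

/-! ### Second-order substitution -/

theorem RTree.hom_init_apply {Ω : Type u} {rk : Ω → ℕ} {Γ : Type w} {rk' : Γ → ℕ}
    (h : Ω → RTree rk' ℕ) (a : Ω) : RTree.hom h (RTree.init (rk := rk) a) = h a := by
  simp only [RTree.init, RTree.hom]
  refine Eq.trans ?_ (RTree.bind_var _)
  congr 1
  funext i
  split_ifs <;> rfl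

namespace MCFTG

section

variable {T : Type v} {rkT : T → ℕ} {N : Type u}

/-- This holds for every `B`, since the irrelevant tree that `lookupTree` returns by default is a
variable. -/
theorem hom_lookupTree {T' : Type w} {rkT' : T' → ℕ} (h : T → RTree rkT' ℕ)
    (C : List N) (ts : List (RTree rkT ℕ)) (B : N) :
    RTree.hom h (lookupTree C ts B) = lookupTree C (ts.map (RTree.hom h)) B := by
  induction C generalizing ts with
  | nil => cases ts <;> rfl
  | cons A C ih =>
    cases ts with
    | nil => rfl
    | cons t ts =>
      simp only [List.map_cons, lookupTree]
      split_ifs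
      · rfl
      · exact ih ts

theorem lookupTree_of_forall₂ {R : N → RTree rkT ℕ → Prop} {C : List N} {ts : List (RTree rkT ℕ)}
    (h : List.Forall₂ R C ts) {B : N} (hB : B ∈ C) : R B (lookupTree C ts B) := by
  induction h with
  | nil => simp at hB
  | cons h1 _ ih =>
    rw [lookupTree]
    split_ifs with hBA
    · rw [hBA]; exact h1
    · exact ih ((List.mem_cons.1 hB).resolve_left hBA)

theorem lookupTree_map_map {X : Type w} {l : List X} {f : X → N} (g : X → RTree rkT ℕ)
    (hl : (l.map f).Nodup) {x : X} (hx : x ∈ l) : lookupTree (l.map f) (l.map g) (f x) = g x := by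
  induction l with
  | nil => simp at hx
  | cons y l ih =>
    rw [List.map_cons, List.nodup_cons] at hl
    simp only [List.map_cons, lookupTree]
    rcases List.mem_cons.1 hx with rfl | hx
    · rw [if_pos rfl]
    · rw [if_neg fun h : f x = f y => hl.1 (h ▸ List.mem_map_of_mem (f := f) hx), ih hl.2 hx]

theorem map_lookupTree_self {C : List N} {ts : List (RTree rkT ℕ)} (hC : C.Nodup)
    (hl : C.length = ts.length) : C.map (lookupTree C ts) = ts := by
  obtain ⟨h1, h2⟩ : (C.zip ts).map Prod.fst = C ∧ (C.zip ts).map Prod.snd = ts :=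
    ⟨List.map_fst_zip hl.le, List.map_snd_zip hl.ge⟩
  generalize C.zip ts = l at h1 h2
  subst h1 h2
  rw [List.map_map]
  exact List.map_congr_left fun x hx => lookupTree_map_map Prod.snd hC hx

end

variable {T : Type v} [Fintype T] {rkT : T → ℕ}

/-! ### Keys: big nonterminals annotated with shapes -/

/-- A big nonterminal together with a shape for each of its elements. -/
@[ext]
structure Key (G : MCFTG.{u, v} rkT) : Type u where
  big : List G.N
  shapes : List (Shape (maxRank rkT))
  mem_big : big ∈ G.big
  good : List.Forall₂ (fun C s => GoodShape (maxRank rkT) (G.rkN C) s) big shapes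

instance (G : MCFTG.{u, v} rkT) : Finite G.Key := by
  have h : (⋃ A ∈ G.big, Prod.mk A ''
      {σ | List.Forall₂ (fun C s => GoodShape (maxRank rkT) (G.rkN C) s) A σ}).Finite :=
    G.big.finite_toSet.biUnion fun A _ =>
      (Set.Finite.setOf_forall₂ (fun C => finite_setOf_goodShape _ (G.rkN C)) A).image _
  have := h.to_subtype
  refine Finite.of_injective (β := ↥(⋃ A ∈ G.big, Prod.mk A ''
      {σ | List.Forall₂ (fun C s => GoodShape (maxRank rkT) (G.rkN C) s) A σ}))
    (fun κ => ⟨(κ.big, κ.shapes), Set.mem_biUnion κ.mem_big ⟨κ.shapes, κ.good, rfl⟩⟩)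
    fun κ κ' hκ => ?_
  have h2 := congrArg Subtype.val hκ
  exact Key.ext (congrArg Prod.fst h2) (congrArg Prod.snd h2)

noncomputable instance (G : MCFTG.{u, v} rkT) : Fintype G.Key := Fintype.ofFinite _

/-- The bound on the number of pieces of a forest derived from a big nonterminal. -/
def maxPieces (G : MCFTG.{u, v} rkT) : ℕ :=
  G.big.sup fun A => (A.map fun C => RTree.pieceBound (maxRank rkT) (G.rkN C)).sum

theorem maxPieces_le (G : MCFTG.{u, v} rkT) (hwid : 1 ≤ G.width) :
    G.maxPieces ≤ G.multiplicity * maxRank rkT * (2 * G.width - 1) := by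
  refine Finset.sup_le fun A hA => ?_
  have hC : ∀ C, RTree.pieceBound (maxRank rkT) (G.rkN C) ≤ maxRank rkT * (2 * G.width - 1) := by
    intro C
    have h1 := G.one_le_maxRank
    have h2 : G.rkN C ≤ G.width := @le_maxRank _ G.fintypeN G.rkN C
    rw [RTree.pieceBound]
    split_ifs
    · exact Nat.mul_pos h1 (by omega)
    · exact Nat.mul_le_mul_left _ (by omega)
  calc (A.map fun C => RTree.pieceBound (maxRank rkT) (G.rkN C)).sum
      ≤ A.length * (maxRank rkT * (2 * G.width - 1)) := by
        rw [← smul_eq_mul, ← List.length_map]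
        refine List.sum_le_card_nsmul _ _ fun x hx => ?_
        obtain ⟨C, _, rfl⟩ := List.mem_map.1 hx
        exact hC C
    _ ≤ G.multiplicity * (maxRank rkT * (2 * G.width - 1)) :=
        Nat.mul_le_mul_right _ (Finset.le_sup (f := List.length) hA)
    _ = _ := (mul_assoc _ _ _).symm

/-- The nonterminals of the footed grammar. A nonterminal consists of a key, the rank of a piece,
and the index of the piece among the pieces of the key. The rank is stored in order that the rank
of the nonterminal is definitionally that of the node of the shape. -/
abbrev Name (G : MCFTG.{u, v} rkT) : Type u :=
  G.Key × Fin (maxRank rkT + 1) × Fin (G.maxPieces + 1)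

/-- The rank of a nonterminal of the footed grammar. -/
def nameRank (G : MCFTG.{u, v} rkT) (n : G.Name) : ℕ := (n.2.1 : ℕ)

namespace Key

variable {G : MCFTG.{u, v} rkT} (κ : G.Key)

/-- The ranks and addresses of the pieces of a key. -/
def slots : List (Fin (maxRank rkT + 1) × List ℕ) :=
  (RTree.addrForest κ.shapes).flatMap RTree.syms

/-- The nonterminal for a rank and an address. Addresses are replaced by their indices among the
addresses of the key, so that there are finitely many nonterminals; `Fin.ofNat` does not wrap around
because a key has at most `G.maxPieces` pieces. -/
def slotName (x : Fin (maxRank rkT + 1) × List ℕ) : G.Name :=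
  (κ, x.1, Fin.ofNat _ ((κ.slots.map Prod.snd).idxOf x.2))

/-- The big nonterminal of the footed grammar that is determined by a key. It is empty if all
shapes of the key are variables. -/
def names : List G.Name := κ.slots.map κ.slotName

/-- A shape with addresses, as a tree over the nonterminals of the footed grammar. -/
def nameTree (t : RTree (fun x : Fin (maxRank rkT + 1) × List ℕ => (x.1 : ℕ)) ℕ) :
    RTree (Sum.elim G.nameRank rkT) ℕ :=
  RTree.relabel (rk' := Sum.elim G.nameRank rkT) (fun x => Sum.inl (κ.slotName x)) t

/-- The shapes of a key, as trees over the nonterminals of the footed grammar. -/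
def skel : List (RTree (Sum.elim G.nameRank rkT) ℕ) :=
  (RTree.addrForest κ.shapes).map κ.nameTree

theorem vars_nameTree (t) : (κ.nameTree t).vars = t.vars :=
  RTree.vars_relabel _ _

theorem syms_nameTree (t) : (κ.nameTree t).syms = t.syms.map fun x => Sum.inl (κ.slotName x) :=
  RTree.syms_relabel _ _

theorem hom_nameTree {Γ : Type w} {rk' : Γ → ℕ} (h : G.Name ⊕ T → RTree rk' ℕ) (t) :
    RTree.hom h (κ.nameTree t) = RTree.hom (fun x => h (Sum.inl (κ.slotName x))) t :=
  RTree.hom_relabel _ _ _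

theorem length_slots_le : κ.slots.length ≤ G.maxPieces := by
  refine le_trans ?_ (Finset.le_sup κ.mem_big)
  rw [slots, RTree.length_addrForest_syms]
  refine List.Forall₂.sum_le_sum ?_
  rw [List.forall₂_map_left_iff, List.forall₂_map_right_iff]
  exact κ.good.flip.imp fun _ _ h => h.length_le

theorem length_names_le : κ.names.length ≤ G.maxPieces := by
  rw [names, List.length_map]
  exact κ.length_slots_le

theorem nodup_names : κ.names.Nodup := by
  have h := RTree.nodup_addrForest κ.shapes
  refine (List.Nodup.of_map _ h).map_on fun x hx y hy hxy => ?_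
  have hlt : ∀ z ∈ κ.slots, (κ.slots.map Prod.snd).idxOf z.2 < G.maxPieces + 1 := fun z hz => by
    have h1 := List.idxOf_lt_length_of_mem (List.mem_map_of_mem (f := Prod.snd) hz)
    have h2 := κ.length_slots_le
    rw [List.length_map] at h1
    omega
  have h3 := congrArg (fun n : G.Name => (n.2.2 : ℕ)) hxy
  simp only [slotName, Fin.ofNat] at h3
  rw [Nat.mod_eq_of_lt (hlt x hx), Nat.mod_eq_of_lt (hlt y hy)] at h3
  have h4 : x.2 = y.2 :=
    (List.idxOf_inj (List.mem_map_of_mem (f := Prod.snd) hx)).1 h3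
  exact Prod.ext (congrArg (fun n : G.Name => n.2.1) hxy) h4

variable {κ}

theorem fst_of_mem_names {n : G.Name} (h : n ∈ κ.names) : n.1 = κ := by
  obtain ⟨x, _, rfl⟩ := List.mem_map.1 h
  rfl

theorem eq_of_mem_names {κ' : G.Key} {n : G.Name} (h : n ∈ κ.names) (h' : n ∈ κ'.names) :
    κ = κ' := (fst_of_mem_names h).symm.trans (fst_of_mem_names h')

theorem eq_of_names_eq {κ' : G.Key} (h : κ.names = κ'.names) (hne : κ.names ≠ []) : κ = κ' := by
  obtain ⟨n, hn⟩ := List.exists_mem_of_ne_nil _ hne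
  exact eq_of_mem_names hn (h ▸ hn)

variable (κ)

theorem map_vars_skel : κ.skel.map RTree.vars = κ.shapes.map RTree.vars := by
  conv_rhs => rw [← RTree.map_relabel_fst_addrForest κ.shapes]
  rw [skel, List.map_map, List.map_map]
  refine List.map_congr_left fun t _ => ?_
  exact (κ.vars_nameTree t).trans (RTree.vars_relabel _ _).symm

theorem flatMap_syms_skel : κ.skel.flatMap RTree.syms = κ.names.map Sum.inl := by
  rw [skel, names, slots, List.map_map, List.map_flatMap, List.flatMap_map]
  exact List.flatMap_congr fun t _ => κ.syms_nameTree t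

theorem forall₂_isPattern_skel :
    List.Forall₂ (fun C t => RTree.IsPattern (G.rkN C) t) κ.big κ.skel := by
  have h : List.Forall₂ (fun C l => List.Perm l (List.range (G.rkN C))) κ.big
      (κ.shapes.map RTree.vars) := by
    rw [List.forall₂_map_right_iff]
    exact κ.good.imp fun _ _ h => h.isPattern
  rw [← map_vars_skel, List.forall₂_map_right_iff] at h
  exact h

end Key

end MCFTG

/-! ### Rules of the footed grammar -/

namespace MCFTG

variable {T : Type v} [Fintype T] {rkT : T → ℕ}

/-- The links of a rule partition the nonterminals of its right-hand side. -/
theorem flatten_linkOrder_perm {G : MCFTG.{u, v} rkT} (ρ : G.Rules) :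
    (G.linkOrder ρ.1).flatten.Perm ρ.1.rhsNonterminals := by
  have wf := G.rules_wf ρ.1 ρ.2
  have hn := G.linkOrder_nodup ρ.1 ρ.2
  have hm := G.mem_linkOrder ρ.1 ρ.2
  rw [List.perm_ext_iff_of_nodup _ wf.uniquely_labeled]
  · intro C
    rw [List.mem_flatten, wf.links_cover]
    simp only [hm]
  · rw [List.nodup_flatten]
    refine ⟨fun B hB => G.big_nodup B (wf.links_subset ((hm B).1 hB)), ?_⟩
    refine hn.imp_of_mem fun {B B'} hB hB' hne C hC hC' => hne ?_
    exact wf.links_disjoint B ((hm B).1 hB) B' ((hm B').1 hB') C hC hC'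

theorem rank_le_maxRank (G : MCFTG.{u, v} rkT) (a : G.Name ⊕ T) :
    Sum.elim G.nameRank rkT a ≤ maxRank rkT := by
  rcases a with n | a
  · exact Nat.le_of_lt_succ n.2.1.2
  · exact le_maxRank rkT a

/-- An instance of a rule: a rule together with a key for each of its links. -/
structure Inst (G : MCFTG.{u, v} rkT) where
  rule : G.Rules
  arg : Fin (G.ruleRank rule) → G.Key
  arg_big : ∀ i : Fin (G.ruleRank rule), (arg i).big = (G.linkOrder rule.1).get i

namespace Inst

variable {G : MCFTG.{u, v} rkT} (I : G.Inst)

/-- The shapes of the links, which are substituted for the nonterminals of the rule. -/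
noncomputable def subst : G.N ⊕ T → RTree (Sum.elim G.nameRank rkT) ℕ :=
  Sum.elim
    (lookupTree (G.linkOrder I.rule.1).flatten (List.ofFn fun i => (I.arg i).skel).flatten)
    fun a => RTree.init (Sum.inr a)

/-- The right-hand side of the rule after the substitution of the shapes of the links. -/
noncomputable def forest : List (RTree (Sum.elim G.nameRank rkT) ℕ) :=
  I.rule.1.rhs.map (RTree.hom I.subst)

/-- The decomposition of the forest into pieces. -/
noncomputable def decForest : List (RTree.PieceTree (Sum.elim G.nameRank rkT) (maxRank rkT)) :=
  I.forest.map (RTree.dec G.rank_le_maxRank)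

/-- The shape of a tree of pieces. -/
def _root_.RTree.PieceTree.shape {Ω : Type u} {rk : Ω → ℕ} {m : ℕ} (t : RTree.PieceTree rk m) :
    Shape m :=
  RTree.relabel (rk' := fun r : Fin (m + 1) => (r : ℕ)) Prod.snd t

theorem forall₂_linkOrder :
    List.Forall₂ (fun C t => RTree.IsPattern (G.rkN C) t) (G.linkOrder I.rule.1).flatten
      (List.ofFn fun i => (I.arg i).skel).flatten := by
  refine List.rel_flatten ?_
  conv_lhs => rw [← List.ofFn_get (G.linkOrder I.rule.1)]
  refine List.forall₂_ofFn fun i => ?_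
  rw [← I.arg_big i]
  exact (I.arg i).forall₂_isPattern_skel

theorem isPattern_subst {a : G.N ⊕ T} (ha : a ∈ I.rule.1.rhsSyms) :
    RTree.IsPattern (Sum.elim G.rkN rkT a) (I.subst a) := by
  rcases a with C | a
  · refine lookupTree_of_forall₂ I.forall₂_linkOrder ?_
    rw [(flatten_linkOrder_perm I.rule).mem_iff, MCRule.rhsNonterminals, List.mem_filterMap]
    exact ⟨_, ha, rfl⟩
  · exact RTree.isPattern_init _

theorem mem_rhsSyms {t : RTree (Sum.elim G.rkN rkT) ℕ} (ht : t ∈ I.rule.1.rhs) {a : G.N ⊕ T}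
    (ha : a ∈ t.syms) : a ∈ I.rule.1.rhsSyms :=
  List.mem_flatMap.2 ⟨t, ht, ha⟩

theorem forall₂_isPattern_forest :
    List.Forall₂ (fun C t => RTree.IsPattern (G.rkN C) t) I.rule.1.lhs I.forest := by
  rw [forest, List.forall₂_map_right_iff]
  have h := (G.rules_wf I.rule.1 I.rule.2).rank
  rw [List.forall₂_iff_get] at h ⊢
  refine ⟨h.1, fun i h1 h2 => ?_⟩
  exact (h.2 i h1 h2).hom fun a ha => I.isPattern_subst (I.mem_rhsSyms (List.get_mem _ _) ha)

theorem isPattern_footed_piece {t : RTree.PieceTree (Sum.elim G.nameRank rkT) (maxRank rkT)}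
    (ht : t ∈ I.decForest) {x} (hx : x ∈ t.syms) :
    RTree.IsPattern (x.2 : ℕ) x.1 ∧ RTree.Footed (x.2 : ℕ) x.1 := by
  obtain ⟨s, _, rfl⟩ := List.mem_map.1 ht
  exact RTree.isPattern_footed_of_mem_syms_dec _ s x hx

theorem goodShape_dec {k : ℕ} {t : RTree (Sum.elim G.nameRank rkT) ℕ} (ht : t.IsPattern k) :
    GoodShape (maxRank rkT) k (RTree.dec G.rank_le_maxRank t).shape := by
  constructor
  · have h := RTree.coe_vars_hom Prod.fst (RTree.dec G.rank_le_maxRank t) fun x hx =>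
      (RTree.isPattern_footed_of_mem_syms_dec _ t x hx).1
    rw [RTree.hom_fst_dec, RTree.isPattern_iff.1 ht] at h
    rw [RTree.isPattern_iff, RTree.PieceTree.shape, RTree.vars_relabel, h]
  · rw [RTree.PieceTree.shape, RTree.syms_relabel, List.length_map]
    refine (RTree.length_syms_dec_le _ t).trans_eq ?_
    rw [ht.length_eq, List.length_range]

/-- The key of the left-hand side that is determined by a rule and keys for its links. -/
noncomputable def head : G.Key where
  big := I.rule.1.lhs
  shapes := I.decForest.map RTree.PieceTree.shape
  mem_big := (G.rules_wf I.rule.1 I.rule.2).lhs_mem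
  good := by
    rw [decForest, List.map_map, List.forall₂_map_right_iff]
    exact I.forall₂_isPattern_forest.imp fun _ _ h => goodShape_dec h

/-- The pieces of the right-hand side with their ranks and addresses. -/
noncomputable def pieceSlots :
    List ((RTree (Sum.elim G.nameRank rkT) ℕ × Fin (maxRank rkT + 1)) × List ℕ) :=
  (RTree.addrForest I.decForest).flatMap RTree.syms

/-- The nonterminal for a piece. -/
noncomputable def pieceName
    (x : (RTree (Sum.elim G.nameRank rkT) ℕ × Fin (maxRank rkT + 1)) × List ℕ) : G.Name :=
  I.head.slotName (x.1.2, x.2)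

theorem slots_head : I.head.slots = I.pieceSlots.map fun x => (x.1.2, x.2) := by
  have h := RTree.addrForest_map_relabel (rk' := fun r : Fin (maxRank rkT + 1) => (r : ℕ))
    (Prod.snd : RTree (Sum.elim G.nameRank rkT) ℕ × Fin (maxRank rkT + 1) → _) I.decForest
  rw [Key.slots, pieceSlots, List.map_flatMap]
  refine (congrArg (List.flatMap RTree.syms) h).trans ?_
  rw [List.flatMap_map]
  exact List.flatMap_congr fun t _ => RTree.syms_relabel _ _

theorem names_head : I.head.names = I.pieceSlots.map I.pieceName := by
  rw [Key.names, slots_head, List.map_map]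
  rfl

theorem mem_pieceSlots {t} (ht : t ∈ RTree.addrForest I.decForest) {x} (hx : x ∈ t.syms) :
    x ∈ I.pieceSlots := List.mem_flatMap.2 ⟨t, ht, hx⟩

theorem map_fst_pieceSlots : I.pieceSlots.map Prod.fst = I.decForest.flatMap RTree.syms := by
  conv_rhs => rw [← RTree.map_relabel_fst_addrForest I.decForest]
  rw [pieceSlots, List.map_flatMap, List.flatMap_map]
  exact List.flatMap_congr fun t _ => (RTree.syms_relabel
    (rk' := fun x : RTree (Sum.elim G.nameRank rkT) ℕ × Fin (maxRank rkT + 1) => (x.2 : ℕ))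
    Prod.fst t).symm

theorem isPattern_footed_pieceSlots {x} (hx : x ∈ I.pieceSlots) :
    RTree.IsPattern (x.1.2 : ℕ) x.1.1 ∧ RTree.Footed (x.1.2 : ℕ) x.1.1 := by
  have h := List.mem_map_of_mem (f := Prod.fst) hx
  rw [map_fst_pieceSlots] at h
  obtain ⟨t, ht, hxt⟩ := List.mem_flatMap.1 h
  exact I.isPattern_footed_piece ht hxt

/-- The rule of the footed grammar, whose right-hand side consists of the pieces. Links whose keys
have no pieces are omitted, since big nonterminals are nonempty. -/
noncomputable def toRule : MCRule G.nameRank rkT where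
  lhs := I.head.names
  rhs := I.pieceSlots.map fun x => x.1.1
  links := ((Set.finite_range fun i => (I.arg i).names).subset
    (Set.sdiff_subset (t := {[]}))).toFinset

theorem mem_links_toRule {B : List G.Name} :
    B ∈ I.toRule.links ↔ (∃ i, (I.arg i).names = B) ∧ B ≠ [] := by
  simp [toRule]

/-- The pieces contain the same occurrences of symbols as the trees that they are cut from. -/
theorem coe_rhsSyms_toRule :
    (I.toRule.rhsSyms : Multiset (G.Name ⊕ T)) =
      (I.rule.1.rhsSyms.map fun a => ((I.subst a).syms : Multiset (G.Name ⊕ T))).sum := by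
  have h1 : ∀ t ∈ I.forest,
      (((RTree.dec G.rank_le_maxRank t).syms.map fun x =>
        (x.1.syms : Multiset (G.Name ⊕ T))).sum) = (t.syms : Multiset (G.Name ⊕ T)) := by
    intro t _
    rw [← RTree.coe_syms_hom (h := Prod.fst) _ fun x hx =>
      (RTree.isPattern_footed_of_mem_syms_dec _ t x hx).1, RTree.hom_fst_dec]
  have h2 : ∀ t ∈ I.rule.1.rhs, ((RTree.hom I.subst t).syms : Multiset (G.Name ⊕ T)) =
      (t.syms.map fun a => ((I.subst a).syms : Multiset (G.Name ⊕ T))).sum := fun t ht =>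
    RTree.coe_syms_hom _ _ fun a ha => I.isPattern_subst (I.mem_rhsSyms ht ha)
  rw [MCRule.rhsSyms, toRule, List.flatMap_map, List.coe_flatMap]
  calc (I.pieceSlots.map fun x => (x.1.1.syms : Multiset (G.Name ⊕ T))).sum
      = ((I.pieceSlots.map Prod.fst).map fun x => (x.1.syms : Multiset (G.Name ⊕ T))).sum := by
        rw [List.map_map]; rfl
    _ = (I.forest.map fun t => (t.syms : Multiset (G.Name ⊕ T))).sum := by
        rw [map_fst_pieceSlots, decForest, List.flatMap_map, List.map_flatMap, List.flatMap_def,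
          List.sum_flatten, List.map_map]
        exact congrArg _ (List.map_congr_left h1)
    _ = _ := by
        rw [forest, List.map_map, MCRule.rhsSyms, List.map_flatMap, List.flatMap_def,
          List.sum_flatten, List.map_map]
        exact congrArg _ (List.map_congr_left h2)

theorem inr_mem_rhsSyms_toRule {δ : T} (h : Sum.inr δ ∈ I.rule.1.rhsSyms) :
    Sum.inr δ ∈ I.toRule.rhsSyms := by
  rw [← Multiset.mem_coe, coe_rhsSyms_toRule, ← List.coe_flatMap, Multiset.mem_coe,
    List.mem_flatMap]
  refine ⟨_, h, ?_⟩
  rw [subst, Sum.elim_inr, RTree.syms_init]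
  exact List.mem_singleton_self _

/-- The nonterminals of the right-hand side are those of the keys of the links. -/
theorem rhsNonterminals_toRule_perm :
    I.toRule.rhsNonterminals.Perm (List.ofFn fun i => (I.arg i).names).flatten := by
  have h1 : I.toRule.rhsSyms.Perm (I.rule.1.rhsSyms.flatMap fun a => (I.subst a).syms) := by
    rw [← Multiset.coe_eq_coe, coe_rhsSyms_toRule, List.coe_flatMap]
  have h2 : (I.rule.1.rhsSyms.flatMap fun a => (I.subst a).syms).filterMap Sum.getLeft? =
      I.rule.1.rhsNonterminals.flatMap fun C =>
        (I.subst (Sum.inl C)).syms.filterMap Sum.getLeft? := by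
    rw [MCRule.rhsNonterminals]
    induction I.rule.1.rhsSyms with
    | nil => rfl
    | cons a l ih =>
      rw [List.flatMap_cons, List.filterMap_append, ih]
      rcases a with C | a
      · rfl
      · rw [subst, Sum.elim_inr, RTree.syms_init]
        rfl
  have h3 : (G.linkOrder I.rule.1).flatten.map (fun C => I.subst (Sum.inl C)) =
      (List.ofFn fun i => (I.arg i).skel).flatten := by
    refine map_lookupTree_self ?_ I.forall₂_linkOrder.length_eq
    exact (flatten_linkOrder_perm I.rule).nodup_iff.2
      (G.rules_wf I.rule.1 I.rule.2).uniquely_labeled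
  refine (h1.filterMap Sum.getLeft?).trans ?_
  rw [h2]
  refine ((flatten_linkOrder_perm I.rule).flatMap_right _).symm.trans ?_
  have h4 : (G.linkOrder I.rule.1).flatten.flatMap
      (fun C => (I.subst (Sum.inl C)).syms.filterMap Sum.getLeft?) =
      ((G.linkOrder I.rule.1).flatten.map fun C => I.subst (Sum.inl C)).flatMap
        fun t => t.syms.filterMap Sum.getLeft? := by
    rw [List.flatMap_map]
  rw [h4, h3]
  refine List.Perm.of_eq ?_
  rw [List.flatMap_def, List.map_flatten, List.map_ofFn, List.flatten_flatten, List.map_ofFn]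
  congr 2
  funext i
  simp only [Function.comp_apply]
  rw [← List.flatMap_def, ← List.filterMap_flatMap, Key.flatMap_syms_skel, List.filterMap_map]
  exact List.filterMap_some

variable {I} in
theorem arg_injective {i j} (h : I.arg i = I.arg j) : i = j := by
  have h1 := congrArg Key.big h
  rw [I.arg_big, I.arg_big] at h1
  exact (List.nodup_iff_injective_get.1 (G.linkOrder_nodup I.rule.1 I.rule.2)) h1

theorem mem_rhsNonterminals_toRule {n : G.Name} :
    n ∈ I.toRule.rhsNonterminals ↔ ∃ i, n ∈ (I.arg i).names := by
  rw [(rhsNonterminals_toRule_perm I).mem_iff, List.mem_flatten_ofFn]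

theorem wellFormed_toRule {big : Finset (List G.Name)} (hhead : I.head.names ∈ big)
    (hargs : ∀ i, (I.arg i).names ≠ [] → (I.arg i).names ∈ big) : I.toRule.WellFormed big where
  lhs_mem := hhead
  rank := by
    change List.Forall₂ _ I.head.names (I.pieceSlots.map _)
    rw [names_head, List.forall₂_map_left_iff, List.forall₂_map_right_iff, List.forall₂_same]
    exact fun x hx => (I.isPattern_footed_pieceSlots hx).1
  uniquely_labeled := by
    rw [(rhsNonterminals_toRule_perm I).nodup_iff, List.nodup_flatten]
    constructor
    · intro l hl
      obtain ⟨i, rfl⟩ := List.mem_ofFn.1 hl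
      exact (I.arg i).nodup_names
    · rw [List.pairwise_ofFn]
      exact fun i j hij n hi hj => hij.ne (arg_injective (Key.eq_of_mem_names hi hj))
  links_subset B hB := by
    obtain ⟨⟨i, rfl⟩, h⟩ := I.mem_links_toRule.1 hB
    exact hargs i h
  links_cover n := by
    rw [mem_rhsNonterminals_toRule]
    constructor
    · rintro ⟨i, hi⟩
      exact ⟨_, I.mem_links_toRule.2 ⟨⟨i, rfl⟩, List.ne_nil_of_mem hi⟩, hi⟩
    · rintro ⟨B, hB, hn⟩
      obtain ⟨⟨i, rfl⟩, _⟩ := I.mem_links_toRule.1 hB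
      exact ⟨i, hn⟩
  links_disjoint B hB B' hB' n hn hn' := by
    obtain ⟨⟨i, rfl⟩, _⟩ := I.mem_links_toRule.1 hB
    obtain ⟨⟨j, rfl⟩, _⟩ := I.mem_links_toRule.1 hB'
    rw [Key.eq_of_mem_names hn hn']

theorem footed_toRule : I.toRule.Footed := by
  change List.Forall₂ _ I.head.names (I.pieceSlots.map _)
  rw [names_head, List.forall₂_map_left_iff, List.forall₂_map_right_iff, List.forall₂_same]
  exact fun x hx => (I.isPattern_footed_pieceSlots hx).2

theorem terminal_toRule (h : I.rule.1.Terminal) : I.toRule.Terminal := by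
  have h0 : (G.linkOrder I.rule.1).flatten = [] := by
    have := flatten_linkOrder_perm I.rule
    rw [h] at this
    exact this.eq_nil
  refine List.eq_nil_iff_forall_not_mem.2 fun n hn => ?_
  obtain ⟨i, _⟩ := I.mem_rhsNonterminals_toRule.1 hn
  have hmem := List.get_mem (G.linkOrder I.rule.1) i
  have hne := G.big_ne_nil _ ((G.rules_wf _ I.rule.2).links_subset
    ((G.mem_linkOrder _ I.rule.2 _).1 hmem))
  exact hne (List.flatten_eq_nil_iff.1 h0 _ hmem)

/-! ### Values -/

/-- Given values of the nonterminals of the links, the value of the right-hand side of the rule is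
obtained from the shapes of its key by substituting the values of the pieces. -/
theorem applyRule_eq {h : G.Name ⊕ T → RTree rkT ℕ} (hr : ∀ a, h (Sum.inr a) = RTree.init a)
    (hl : ∀ i, ∀ n ∈ (I.arg i).names, RTree.IsPattern (G.nameRank n) (h (Sum.inl n))) :
    List.Forall₂ (fun n t => RTree.IsPattern (G.nameRank n) t) I.head.names
        (I.toRule.rhs.map (RTree.hom h)) ∧
      G.applyRule I.rule.1 (List.ofFn fun i => (I.arg i).skel.map (RTree.hom h)) =
        I.head.skel.map
          (RTree.hom (substHom I.head.names (I.toRule.rhs.map (RTree.hom h)))) := by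
  have hp : ∀ a ∈ I.toRule.rhsSyms, RTree.IsPattern (Sum.elim G.nameRank rkT a) (h a) := by
    rintro (n | a) ha
    · obtain ⟨i, hi⟩ := I.mem_rhsNonterminals_toRule.1 (List.mem_filterMap.2 ⟨_, ha, rfl⟩)
      exact hl i n hi
    · rw [hr]
      exact RTree.isPattern_init a
  have hpieces : ∀ x ∈ I.pieceSlots, ∀ a ∈ x.1.1.syms, a ∈ I.toRule.rhsSyms := fun x hx a ha =>
    List.mem_flatMap.2 ⟨_, List.mem_map_of_mem hx, ha⟩
  constructor
  · change List.Forall₂ _ I.head.names ((I.pieceSlots.map _).map _)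
    rw [names_head, List.map_map, List.forall₂_map_left_iff, List.forall₂_map_right_iff,
      List.forall₂_same]
    exact fun x hx => (I.isPattern_footed_pieceSlots hx).1.hom fun a ha => hp a (hpieces x hx a ha)
  · trans I.forest.map (RTree.hom h)
    -- Substituting the values of the links amounts to substituting their shapes, followed by `h`.
    · rw [applyRule, forest, List.map_map]
      refine List.map_congr_left fun t ht => ?_
      rw [Function.comp_apply, RTree.hom_hom]
      · refine RTree.hom_congr t fun a _ => ?_
        rcases a with C | a
        · have hfl : (List.ofFn fun i => (I.arg i).skel.map (RTree.hom h)).flatten =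
              (List.ofFn fun i => (I.arg i).skel).flatten.map (RTree.hom h) := by
            rw [List.map_flatten, List.map_ofFn]
            rfl
          rw [substHom, hfl, subst, Sum.elim_inl, hom_lookupTree]
        · rw [substHom, subst, Sum.elim_inr, RTree.hom_init_apply, hr]
      · intro a ha b hb x hx
        refine (hp b ?_).lt hx
        rw [← Multiset.mem_coe, coe_rhsSyms_toRule, ← List.coe_flatMap, Multiset.mem_coe]
        exact List.mem_flatMap.2 ⟨a, I.mem_rhsSyms ht ha, hb⟩
    -- Both forests are images of the addressed forest of pieces: the skeleton of the head replaces
    -- its symbols by the names of the pieces, and `I.forest` by the pieces themselves.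
    · have hs : I.head.skel = (RTree.addrForest I.decForest).map fun t =>
          I.head.nameTree (RTree.relabel
            (rk' := fun x : Fin (maxRank rkT + 1) × List ℕ => (x.1 : ℕ))
            (fun x : (RTree (Sum.elim G.nameRank rkT) ℕ × Fin (maxRank rkT + 1)) × List ℕ =>
              (x.1.2, x.2)) t) := by
        have h' := RTree.addrForest_map_relabel (rk' := fun r : Fin (maxRank rkT + 1) => (r : ℕ))
          (Prod.snd : RTree (Sum.elim G.nameRank rkT) ℕ × Fin (maxRank rkT + 1) → _) I.decForest
        rw [Key.skel]
        refine (congrArg (List.map I.head.nameTree) h').trans ?_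
        rw [List.map_map]
        rfl
      have hf : I.forest = (RTree.addrForest I.decForest).map fun t =>
          RTree.hom Prod.fst (RTree.relabel
            (rk' := fun x : RTree (Sum.elim G.nameRank rkT) ℕ × Fin (maxRank rkT + 1) => (x.2 : ℕ))
            Prod.fst t) := by
        have h' := RTree.map_relabel_fst_addrForest I.decForest
        have h'' := congrArg (List.map (RTree.hom Prod.fst)) h'
        rw [List.map_map] at h''
        refine Eq.trans ?_ h''.symm
        rw [decForest, List.map_map]
        refine (List.map_id _).symm.trans (List.map_congr_left fun t _ => ?_)
        exact (RTree.hom_fst_dec _ t).symm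
      rw [hs, hf, List.map_map, List.map_map]
      refine List.map_congr_left fun t ht => ?_
      simp only [Function.comp_apply]
      rw [Key.hom_nameTree, RTree.hom_relabel, RTree.hom_relabel, RTree.hom_hom]
      · refine RTree.hom_congr t fun x hx => ?_
        have hx' := I.mem_pieceSlots ht hx
        have hl := lookupTree_map_map (l := I.pieceSlots) (f := I.pieceName)
          (fun x => RTree.hom h x.1.1) (I.names_head ▸ I.head.nodup_names) hx'
        refine Eq.trans hl.symm ?_
        rw [substHom, names_head, toRule, List.map_map]
        rfl
      · intro x hx b hb y hy
        exact (hp b (hpieces x (I.mem_pieceSlots ht hx) b hb)).lt hy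

end Inst

end MCFTG

/-! ### Derivation trees annotated with keys -/

namespace RTree

theorem bind_empty {Ω : Type u} {rk : Ω → ℕ} (t : GTree rk) (f : Empty → GTree rk) :
    t.bind f = t := by
  rw [show f = var from funext fun e => e.elim, bind_var]

end RTree

theorem RTG.isRegularTreeLanguage_gen {Ω : Type u} [Finite Ω] {rk : Ω → ℕ} (H : RTG.{u, w} rk)
    (A : H.NT) : IsRegularTreeLanguage {t | H.Gen A t} := by
  have := H.finite_NT
  obtain ⟨n, ⟨e⟩⟩ := Finite.exists_equiv_fin H.NT
  let H' : RTG.{u, 0} rk :=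
    { NT := Fin n
      finite_NT := inferInstance
      start := e A
      rule := fun B a Bs => H.rule (e.symm B) a fun i => e.symm (Bs i) }
  refine ⟨H', Set.ext fun t => ⟨fun h => ?_, fun h => ?_⟩⟩
  · have key : ∀ B t, H'.Gen B t → H.Gen (e.symm B) t := by
      intro B t h
      induction h with
      | node B a Bs ts hr _ ih => exact Gen.node _ a _ ts hr ih
    have := key _ t h
    rwa [show H'.start = e A from rfl, e.symm_apply_apply] at this
  · have key : ∀ B t, H.Gen B t → H'.Gen (e B) t := by
      intro B t h
      induction h with
      | node B a Bs ts hr _ ih =>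
        refine Gen.node (H := H') _ a (fun i => e (Bs i)) ts ?_ ih
        simpa [H'] using hr
    exact key A t h

theorem isRegularTreeLanguage_univ {Ω : Type u} [Finite Ω] {rk : Ω → ℕ} :
    IsRegularTreeLanguage (Set.univ : Set (GTree rk)) := by
  let H : RTG.{u, 0} rk := ⟨Unit, inferInstance, (), fun _ _ _ => True⟩
  refine ⟨H, Set.eq_univ_of_forall fun t => ?_⟩
  change H.Gen () t
  induction t with
  | var e => exact e.elim
  | node a ts ih => exact RTG.Gen.node (H := H) () a (fun _ => ()) ts trivial ih

namespace MCFTG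

section

variable {T : Type v} {rkT : T → ℕ} {N : Type u}

open Classical in
theorem lookupTree_append {C C' : List N} {ts ts' : List (RTree rkT ℕ)}
    (hl : C.length = ts.length) (B : N) :
    lookupTree (C ++ C') (ts ++ ts') B =
      if B ∈ C then lookupTree C ts B else lookupTree C' ts' B := by
  induction C generalizing ts with
  | nil =>
    obtain rfl := List.length_eq_zero_iff.1 hl.symm
    simp
  | cons A C ih =>
    obtain ⟨t, ts, rfl⟩ := List.exists_cons_of_length_pos (hl ▸ Nat.succ_pos _ : 0 < ts.length)
    simp only [List.cons_append, lookupTree, List.mem_cons]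
    rw [ih (Nat.succ.inj hl)]
    by_cases h1 : B = A <;> by_cases h2 : B ∈ C <;> simp [h1, h2]

theorem lookupTree_flatten {k : ℕ} {Cs : Fin k → List N} {tss : Fin k → List (RTree rkT ℕ)}
    (hl : ∀ j, (Cs j).length = (tss j).length) {B : N}
    (hd : ∀ i j, B ∈ Cs i → B ∈ Cs j → i = j) {j : Fin k} (hB : B ∈ Cs j) :
    lookupTree (List.ofFn Cs).flatten (List.ofFn tss).flatten B = lookupTree (Cs j) (tss j) B := by
  classical
  induction k with
  | zero => exact j.elim0
  | succ k ih =>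
    rw [List.ofFn_succ, List.ofFn_succ, List.flatten_cons, List.flatten_cons,
      lookupTree_append (hl 0)]
    split_ifs with h0
    · rw [hd j 0 hB h0]
    · obtain ⟨i, rfl⟩ : ∃ i, j = Fin.succ i :=
        Fin.exists_succ_eq_of_ne_zero (fun h => h0 (h ▸ hB)) |>.imp fun _ h => h.symm
      exact ih (fun j => hl j.succ)
        (fun i j hi hj => Fin.succ_injective _ (hd _ _ hi hj)) hB

end

variable {T : Type v} [Fintype T] {rkT : T → ℕ}

/-- The regular tree grammar that computes the keys of derivation trees. The initial nonterminal
`κ₀` is irrelevant. -/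
noncomputable def keyGrammar (G : MCFTG.{u, v} rkT) (κ₀ : G.Key) : RTG.{max u v, u} G.ruleRank where
  NT := G.Key
  finite_NT := inferInstance
  start := κ₀
  rule κ ρ κs := ∃ h, (⟨ρ, κs, h⟩ : G.Inst).head = κ

/-- `G.HasKey κ d`: the derivation tree `d` has type `κ.big`, and the shapes of its value are those
of `κ`. -/
inductive HasKey (G : MCFTG.{u, v} rkT) : G.Key → GTree G.ruleRank → Prop
  | node (I : G.Inst) (ds : Fin (G.ruleRank I.rule) → GTree G.ruleRank) :
      (∀ i, HasKey G (I.arg i) (ds i)) → HasKey G I.head (RTree.node I.rule ds)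

theorem isRegularTreeLanguage_hasKey (G : MCFTG.{u, v} rkT) (κ : G.Key) :
    IsRegularTreeLanguage {d | G.HasKey κ d} := by
  have h1 : ∀ κ' d, G.HasKey κ' d → (G.keyGrammar κ).Gen κ' d := by
    intro κ' d h
    induction h with
    | node I ds _ ih =>
      exact RTG.Gen.node (H := G.keyGrammar κ) _ I.rule I.arg ds ⟨I.arg_big, rfl⟩ ih
  have h2 : ∀ κ' d, (G.keyGrammar κ).Gen κ' d → G.HasKey κ' d := by
    intro κ' d h
    induction h with
    | node κ' ρ κs ds hr _ ih =>
      obtain ⟨h, rfl⟩ := hr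
      exact HasKey.node ⟨ρ, κs, h⟩ ds ih
  rw [show {d | G.HasKey κ d} = {d | (G.keyGrammar κ).Gen κ d} from
    Set.ext fun d => ⟨h1 κ d, h2 κ d⟩]
  exact (G.keyGrammar κ).isRegularTreeLanguage_gen κ

variable {G : MCFTG.{u, v} rkT}

/-- A derivation tree has at most one key, which makes the look-ahead deterministic. -/
theorem HasKey.unique {κ κ' : G.Key} {d : GTree G.ruleRank} (h : G.HasKey κ d)
    (h' : G.HasKey κ' d) : κ = κ' := by
  induction h generalizing κ' with
  | node I ds _ ih =>
    obtain ⟨ρ, arg, h⟩ := I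
    cases h' with
    | node I' _ h'' =>
      obtain rfl : arg = I'.arg := funext fun i => ih i (h'' i)
      rfl

theorem HasKey.gen {κ : G.Key} {d : GTree G.ruleRank} (h : G.HasKey κ d) :
    G.derGrammar.Gen ⟨κ.big, κ.mem_big⟩ d := by
  induction h with
  | node I ds _ ih =>
    exact RTG.Gen.node (H := G.derGrammar) _ I.rule
      (fun i => ⟨(I.arg i).big, (I.arg i).mem_big⟩) ds ⟨rfl, fun i => I.arg_big i⟩ ih

theorem exists_hasKey {A : G.derGrammar.NT} {d : GTree G.ruleRank}
    (h : G.derGrammar.Gen A d) : ∃ κ, G.HasKey κ d ∧ κ.big = A.1 := by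
  induction h with
  | node A ρ Bs ds hr _ ih =>
    choose κs h1 h2 using ih
    refine ⟨_, HasKey.node ⟨ρ, κs, fun i => (h2 i).trans (hr.2 i)⟩ ds h1, hr.1⟩

/-- The value of a derivation tree is in the forest language of its type. -/
theorem gen_val {A : G.derGrammar.NT} {d : GTree G.ruleRank}
    (h : G.derGrammar.Gen A d) : G.Gen A.1 (G.val d) := by
  classical
  induction h with
  | node A ρ Bs ds hr _ ih =>
    let f : List G.N → List (RTree rkT ℕ) := fun B =>
      if h : ∃ i : Fin (G.linkOrder ρ.1).length, (G.linkOrder ρ.1).get i = B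
      then G.val (ds h.choose) else []
    have hf : ∀ i : Fin (G.linkOrder ρ.1).length, f ((G.linkOrder ρ.1).get i) = G.val (ds i) := by
      intro i
      have h : ∃ j : Fin (G.linkOrder ρ.1).length,
          (G.linkOrder ρ.1).get j = (G.linkOrder ρ.1).get i := ⟨i, rfl⟩
      simp only [f]
      rw [dif_pos h, List.nodup_iff_injective_get.1 (G.linkOrder_nodup _ ρ.2) h.choose_spec]
    have hg := Gen.rule ρ.1 f ρ.2 fun B hB => by
      obtain ⟨i, rfl⟩ := List.mem_iff_get.1 ((G.mem_linkOrder _ ρ.2 B).2 hB)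
      rw [hf, ← hr.2 i]
      exact ih i
    rw [hr.1] at hg
    convert hg using 1
    rw [val]
    congr 1
    conv_rhs => rw [← List.ofFn_get (G.linkOrder ρ.1), List.map_ofFn]
    exact congrArg List.ofFn (funext fun i => (hf i).symm)

/-- The forest that is obtained from the shapes of a key by substituting `v` for its pieces. -/
noncomputable def Key.assemble (κ : G.Key) (v : List (RTree rkT ℕ)) : List (RTree rkT ℕ) :=
  κ.skel.map (RTree.hom (substHom κ.names v))

/-- The trees of `v` are patterns of the ranks of the pieces of a key. -/
def Key.Fits (κ : G.Key) (v : List (RTree rkT ℕ)) : Prop :=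
  List.Forall₂ (fun n t => RTree.IsPattern (G.nameRank n) t) κ.names v

theorem Key.map_hom_skel_congr (κ : G.Key) {h h' : G.Name ⊕ T → RTree rkT ℕ}
    (H : ∀ n ∈ κ.names, h (Sum.inl n) = h' (Sum.inl n)) :
    κ.skel.map (RTree.hom h) = κ.skel.map (RTree.hom h') := by
  refine List.map_congr_left fun t ht => RTree.hom_congr t fun a ha => ?_
  have : a ∈ κ.names.map Sum.inl := κ.flatMap_syms_skel ▸ List.mem_flatMap.2 ⟨t, ht, ha⟩
  obtain ⟨n, hn, rfl⟩ := List.mem_map.1 this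
  exact H n hn

/-- The value of a derivation tree has the shapes of its key. -/
theorem HasKey.exists_val_eq {κ : G.Key} {d : GTree G.ruleRank} (h : G.HasKey κ d) :
    ∃ v, κ.Fits v ∧ G.val d = κ.assemble v := by
  induction h with
  | node I ds _ ih =>
    choose v hv1 hv2 using ih
    let h : G.Name ⊕ T → RTree rkT ℕ :=
      substHom (List.ofFn fun i => (I.arg i).names).flatten (List.ofFn v).flatten
    have hh : ∀ i, ∀ n ∈ (I.arg i).names,
        h (Sum.inl n) = substHom (I.arg i).names (v i) (Sum.inl n) := fun i n hn =>
      lookupTree_flatten (Cs := fun i => (I.arg i).names) (fun j => (hv1 j).length_eq)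
        (fun i j hi hj => I.arg_injective (Key.eq_of_mem_names hi hj)) hn
    obtain ⟨h1, h2⟩ := I.applyRule_eq (h := h) (fun _ => rfl) fun i n hn => by
      rw [hh i n hn]
      exact lookupTree_of_forall₂ (hv1 i) hn
    refine ⟨_, h1, Eq.trans ?_ h2⟩
    rw [val]
    congr 2
    funext i
    rw [hv2 i, Key.assemble]
    exact (I.arg i).map_hom_skel_congr fun n hn => (hh i n hn).symm

/-! ### The footed grammar -/

/-- The only key of the big nonterminal `[S]`, whose shape is a single piece of rank `0`. -/
def startKey (G : MCFTG.{u, v} rkT) : G.Key where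
  big := [G.S]
  shapes := [RTree.node ⟨0, Nat.succ_pos _⟩ fun i => i.elim0]
  mem_big := G.S_mem
  good := by
    refine List.Forall₂.cons ?_ List.Forall₂.nil
    rw [G.S_rank]
    exact ⟨by simp [RTree.IsPattern, RTree.vars], by simp [RTree.syms, RTree.pieceBound]⟩

theorem eq_startKey {κ : G.Key} (h : κ.big = [G.S]) : κ = G.startKey := by
  obtain ⟨A, σ, hA, hσ⟩ := κ
  subst h
  obtain ⟨s, σ', hs, hσ', rfl⟩ := List.forall₂_cons_left_iff.1 hσ
  obtain rfl := List.forall₂_nil_left_iff.1 hσ'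
  rw [G.S_rank] at hs
  obtain rfl := hs.eq_node
  rfl

/-- The initial nonterminal of the footed grammar. -/
def startName (G : MCFTG.{u, v} rkT) : G.Name :=
  G.startKey.slotName (⟨0, Nat.succ_pos _⟩, [0])

theorem names_startKey : G.startKey.names = [G.startName] := by
  have h : G.startKey.slots = [(⟨0, Nat.succ_pos _⟩, [0])] := by
    simp [Key.slots, startKey, RTree.addrForest, RTree.addr, RTree.syms]
  rw [Key.names, h]
  rfl

theorem assemble_startKey {v : List (RTree rkT ℕ)} (hv : G.startKey.Fits v) :
    G.startKey.assemble v = v := by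
  rw [Key.Fits, names_startKey] at hv
  obtain ⟨t, v', ht, hv', rfl⟩ := List.forall₂_cons_left_iff.1 hv
  obtain rfl := List.forall₂_nil_left_iff.1 hv'
  have ht0 : t.vars = [] := List.perm_nil.1 ht
  have hs : G.startKey.skel = [RTree.node (Sum.inl G.startName) fun i => Fin.elim0 i] := by
    rw [Key.skel]
    simp only [startKey, RTree.addrForest, List.zipIdx_cons, List.zipIdx_nil, List.map_cons,
      List.map_nil]
    exact congrArg (fun t => [t]) (congrArg (RTree.node (Sum.inl G.startName))
      (funext fun i => Fin.elim0 i))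
  rw [Key.assemble, hs, names_startKey, List.map_cons, List.map_nil, RTree.hom,
    show substHom [G.startName] [t] (Sum.inl G.startName) = t by simp [substHom, lookupTree],
    RTree.bind_of_vars_eq_nil _ ht0]

/-- The keys that are reachable from the key of the initial nonterminal by instances of rules whose
links have keys of actual derivation trees, and that have pieces. They are the keys of the big
nonterminals of the footed grammar, which is therefore reduced. -/
inductive Reach (G : MCFTG.{u, v} rkT) : G.Key → Prop
  | start : Reach G G.startKey
  | step (I : G.Inst) (i : Fin (G.ruleRank I.rule)) : Reach G I.head →
      (∀ j, ∃ d, G.HasKey (I.arg j) d) → (I.arg i).names ≠ [] → Reach G (I.arg i)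

theorem Reach.names_ne_nil {κ : G.Key} (h : G.Reach κ) : κ.names ≠ [] := by
  cases h with
  | start => simp [names_startKey]
  | step I i _ _ h => exact h

theorem Reach.eq_or_exists {κ : G.Key} (h : G.Reach κ) : κ = G.startKey ∨ ∃ d, G.HasKey κ d := by
  cases h with
  | start => exact Or.inl rfl
  | step I i _ h _ => exact Or.inr (h i)

/-- The instances of rules that give rise to rules of the footed grammar. -/
structure Inst.Useful (I : G.Inst) : Prop where
  reach : G.Reach I.head
  hasKey : ∀ i, ∃ d, G.HasKey (I.arg i) d

theorem Inst.Useful.reach_arg {I : G.Inst} (hI : I.Useful) (i : Fin (G.ruleRank I.rule))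
    (h : (I.arg i).names ≠ []) : G.Reach (I.arg i) := Reach.step I i hI.reach hI.hasKey h

instance (G : MCFTG.{u, v} rkT) : Finite G.Inst :=
  Finite.of_injective
    (fun I : G.Inst => (⟨I.rule, I.arg⟩ : (ρ : G.Rules) × (Fin (G.ruleRank ρ) → G.Key)))
    fun ⟨ρ, arg, _⟩ ⟨ρ', arg', _⟩ h => by
      obtain ⟨rfl, h⟩ := Sigma.mk.inj_iff.1 h
      obtain rfl := eq_of_heq h
      rfl

/-- The footed grammar. The big nonterminal of a key consists of one nonterminal for each piece;
keys without pieces disappear. -/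
noncomputable def footedGrammar (G : MCFTG.{u, v} rkT) : MCFTG.{u, v} rkT where
  one_le_maxRank := G.one_le_maxRank
  N := G.Name
  fintypeN := inferInstance
  rkN := G.nameRank
  big := ((Set.toFinite {κ | G.Reach κ}).image Key.names).toFinset
  big_ne_nil A hA := by
    obtain ⟨κ, hκ, rfl⟩ := (Set.Finite.mem_toFinset _).1 hA
    exact Reach.names_ne_nil hκ
  big_nodup A hA := by
    obtain ⟨κ, _, rfl⟩ := (Set.Finite.mem_toFinset _).1 hA
    exact κ.nodup_names
  big_injective A hA A' hA' h := by
    obtain ⟨κ, hκ, rfl⟩ := (Set.Finite.mem_toFinset _).1 hA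
    obtain ⟨κ', _, rfl⟩ := (Set.Finite.mem_toFinset _).1 hA'
    obtain ⟨n, hn⟩ := List.exists_mem_of_ne_nil _ (Reach.names_ne_nil hκ)
    rw [Key.eq_of_mem_names hn ((h n).1 hn)]
  S := G.startName
  S_mem := (Set.Finite.mem_toFinset _).2 ⟨G.startKey, Reach.start, names_startKey⟩
  S_rank := rfl
  rules := ((Set.toFinite {I : G.Inst | I.Useful}).image Inst.toRule).toFinset
  rules_wf ρ hρ := by
    obtain ⟨I, hI, rfl⟩ := (Set.Finite.mem_toFinset _).1 hρ
    exact I.wellFormed_toRule ((Set.Finite.mem_toFinset _).2 ⟨_, hI.reach, rfl⟩)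
      fun i h => (Set.Finite.mem_toFinset _).2 ⟨_, Inst.Useful.reach_arg hI i h, rfl⟩
  linkOrder ρ := ρ.links.toList
  linkOrder_nodup ρ _ := ρ.links.nodup_toList
  mem_linkOrder ρ _ B := Finset.mem_toList

theorem mem_big_footedGrammar {A : List G.Name} :
    A ∈ G.footedGrammar.big ↔ ∃ κ, G.Reach κ ∧ κ.names = A :=
  Set.Finite.mem_toFinset _

theorem mem_rules_footedGrammar {ρ : MCRule G.nameRank rkT} :
    ρ ∈ G.footedGrammar.rules ↔ ∃ I : G.Inst, I.Useful ∧ I.toRule = ρ :=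
  Set.Finite.mem_toFinset _

theorem Reach.mem_big {κ : G.Key} (h : G.Reach κ) : κ.names ∈ G.footedGrammar.big :=
  mem_big_footedGrammar.2 ⟨κ, h, rfl⟩

theorem footed_footedGrammar : G.footedGrammar.Footed := by
  intro ρ hρ
  obtain ⟨I, _, rfl⟩ := mem_rules_footedGrammar.1 hρ
  exact I.footed_toRule

theorem multiplicity_footedGrammar_le : G.footedGrammar.multiplicity ≤ G.maxPieces := by
  refine Finset.sup_le fun A hA => ?_
  obtain ⟨κ, _, rfl⟩ := mem_big_footedGrammar.1 hA
  exact κ.length_names_le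

theorem lexicalized_footedGrammar {Δ : Set T} (h : G.Lexicalized Δ) :
    G.footedGrammar.Lexicalized Δ := by
  intro ρ hρ hp
  obtain ⟨I, _, rfl⟩ := mem_rules_footedGrammar.1 hρ
  obtain ⟨δ, hδ, hm⟩ := h I.rule.1 I.rule.2 fun ⟨h1, h2⟩ => hp <| by
    refine ⟨?_, I.terminal_toRule h2⟩
    change I.head.names = _
    rw [eq_startKey (κ := I.head) h1, names_startKey]
    rfl
  exact ⟨δ, hδ, I.inr_mem_rhsSyms_toRule hm⟩

theorem startSeparated_footedGrammar (h : G.StartSeparated) : G.footedGrammar.StartSeparated := by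
  intro ρ hρ hS
  obtain ⟨I, _, rfl⟩ := mem_rules_footedGrammar.1 hρ
  obtain ⟨i, hi⟩ := I.mem_rhsNonterminals_toRule.1 hS
  have hk : I.arg i = G.startKey :=
    Key.eq_of_mem_names hi (by rw [names_startKey]; exact List.mem_singleton_self _)
  refine h I.rule.1 I.rule.2 ((flatten_linkOrder_perm I.rule).mem_iff.1 ?_)
  refine List.mem_flatten.2 ⟨_, List.get_mem _ i, ?_⟩
  rw [← I.arg_big i, hk]
  exact List.mem_singleton_self _

/-- Corresponding derivation trees of the two grammars have corresponding values, provided that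
their direct subtrees do. -/
theorem Inst.val_eq (I : G.Inst) {ρ : G.footedGrammar.Rules} (hρ : ρ.1 = I.toRule)
    {ds : Fin (G.ruleRank I.rule) → GTree G.ruleRank}
    {ds' : Fin (G.footedGrammar.ruleRank ρ) → GTree G.footedGrammar.ruleRank}
    (hds : ∀ i, G.HasKey (I.arg i) (ds i))
    (hds' : ∀ i j, (G.footedGrammar.linkOrder ρ.1).get j = (I.arg i).names →
      (I.arg i).Fits (G.footedGrammar.val (ds' j)) ∧
        G.val (ds i) = (I.arg i).assemble (G.footedGrammar.val (ds' j))) :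
    I.head.Fits (G.footedGrammar.val (RTree.node ρ ds')) ∧
      G.val (RTree.node I.rule ds) =
        I.head.assemble (G.footedGrammar.val (RTree.node ρ ds')) := by
  obtain ⟨ρ, hρ'⟩ := ρ
  subst hρ
  have hnd := G.footedGrammar.linkOrder_nodup _ hρ'
  have hml := G.footedGrammar.mem_linkOrder _ hρ'
  have harg : ∀ j, ∃ i, (I.arg i).names = (G.footedGrammar.linkOrder I.toRule).get j := fun j =>
    (I.mem_links_toRule.1 ((hml _).1 (List.get_mem _ j))).1
  have hlink : ∀ i, (I.arg i).names ≠ [] →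
      ∃ j, (G.footedGrammar.linkOrder I.toRule).get j = (I.arg i).names := fun i hi =>
    List.mem_iff_get.1 ((hml _).2 (I.mem_links_toRule.2 ⟨⟨i, rfl⟩, hi⟩))
  let h : G.Name ⊕ T → RTree rkT ℕ := substHom (G.footedGrammar.linkOrder I.toRule).flatten
    (List.ofFn fun j => G.footedGrammar.val (ds' j)).flatten
  have hh : ∀ i j, (G.footedGrammar.linkOrder I.toRule).get j = (I.arg i).names →
      ∀ n ∈ (I.arg i).names, h (Sum.inl n) =
        substHom (I.arg i).names (G.footedGrammar.val (ds' j)) (Sum.inl n) := by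
    intro i j hij n hn
    have := lookupTree_flatten (B := n) (j := j) (Cs := (G.footedGrammar.linkOrder I.toRule).get)
      (tss := fun j => G.footedGrammar.val (ds' j)) ?_ ?_ (hij ▸ hn)
    · rw [List.ofFn_get, hij] at this
      exact this
    · intro j
      obtain ⟨i, hi⟩ := harg j
      rw [← hi]
      exact (hds' i j hi.symm).1.length_eq
    · intro j j' hj hj'
      obtain ⟨i, hi⟩ := harg j
      obtain ⟨i', hi'⟩ := harg j'
      refine List.nodup_iff_injective_get.1 hnd ?_
      rw [← hi] at hj ⊢
      rw [← hi'] at hj' ⊢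
      rw [Key.eq_of_mem_names hj hj']
  obtain ⟨h1, h2⟩ := I.applyRule_eq (h := h) (fun _ => rfl) fun i n hn => by
    obtain ⟨j, hj⟩ := hlink i (List.ne_nil_of_mem hn)
    rw [hh i j hj n hn]
    exact lookupTree_of_forall₂ (hds' i j hj).1 hn
  refine ⟨h1, Eq.trans ?_ h2⟩
  rw [val]
  congr 2
  funext i
  by_cases hi : (I.arg i).names = []
  -- Without pieces, the value is determined by the shapes alone.
  · obtain ⟨v, _, hv⟩ := (hds i).exists_val_eq
    rw [hv, Key.assemble]
    exact (I.arg i).map_hom_skel_congr fun n hn => by simp [hi] at hn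
  · obtain ⟨j, hj⟩ := hlink i hi
    rw [(hds' i j hj).2, Key.assemble]
    exact (I.arg i).map_hom_skel_congr fun n hn => (hh i j hj n hn).symm

end MCFTG

namespace MCFTG

variable {T : Type v} [Fintype T] {rkT : T → ℕ} {G : MCFTG.{u, v} rkT}

theorem Inst.exists_arg (I : G.Inst) {ρ : G.footedGrammar.Rules} (hρ : ρ.1 = I.toRule)
    (j : Fin (G.footedGrammar.ruleRank ρ)) :
    ∃ i, (I.arg i).names = (G.footedGrammar.linkOrder ρ.1).get j := by
  have h := (G.footedGrammar.mem_linkOrder _ ρ.2 _).1 (List.get_mem _ j)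
  exact (I.mem_links_toRule.1 ((Finset.ext_iff.1 (congrArg MCRule.links hρ) _).1 h)).1

theorem Inst.exists_link (I : G.Inst) {ρ : G.footedGrammar.Rules} (hρ : ρ.1 = I.toRule)
    (i : Fin (G.ruleRank I.rule)) (hi : (I.arg i).names ≠ []) :
    ∃ j : Fin (G.footedGrammar.ruleRank ρ),
      (G.footedGrammar.linkOrder ρ.1).get j = (I.arg i).names := by
  refine List.mem_iff_get.1 ((G.footedGrammar.mem_linkOrder _ ρ.2 _).2 ?_)
  rw [hρ]
  exact I.mem_links_toRule.2 ⟨⟨i, rfl⟩, hi⟩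

theorem linkOrder_get_injective (G : MCFTG.{u, v} rkT) (ρ : G.Rules)
    {i j : Fin (G.ruleRank ρ)} (h : (G.linkOrder ρ.1).get i = (G.linkOrder ρ.1).get j) : i = j :=
  List.nodup_iff_injective_get.1 (G.linkOrder_nodup ρ.1 ρ.2) h

/-! ### The transducer to the footed grammar -/

/-- The rule of the footed grammar for a useful instance. -/
noncomputable def Inst.Useful.rule {I : G.Inst} (hI : I.Useful) : G.footedGrammar.Rules :=
  ⟨I.toRule, mem_rules_footedGrammar.2 ⟨I, hI, rfl⟩⟩

/-- The transducer rule that outputs the rule of an instance if the look-ahead finds the keys of the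
instance, and deletes the subtrees whose keys have no pieces. -/
noncomputable def Inst.Useful.toFooted {I : G.Inst} (hI : I.Useful) :
    LDTRRule G.ruleRank G.footedGrammar.ruleRank Unit I.rule where
  look0 := Set.univ
  look i := {d | G.HasKey (I.arg i) d}
  out := RTree.node hI.rule fun j => RTree.var ((), (I.exists_arg (ρ := hI.rule) rfl j).choose)

/-- The relabelling of the derivation trees of `G` by instances of rules. -/
noncomputable def toFooted (G : MCFTG.{u, v} rkT) : LDTR G.ruleRank G.footedGrammar.ruleRank where
  Q := Unit
  finite_Q := inferInstance
  q0 := ()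
  rules _ ρ := Set.range fun x : {κs : Fin (G.ruleRank ρ) → G.Key //
    ∃ h, Inst.Useful (⟨ρ, κs, h⟩ : G.Inst)} => Inst.Useful.toFooted x.2.choose_spec
  finite_rules _ _ := Set.finite_range _
  regular_look0 := by
    rintro _ ρ _ ⟨x, rfl⟩
    exact isRegularTreeLanguage_univ
  regular_look := by
    rintro _ ρ _ ⟨x, rfl⟩ i
    exact G.isRegularTreeLanguage_hasKey _
  linear := by
    rintro _ ρ _ ⟨⟨κs, hκs⟩, rfl⟩
    have hI := hκs.choose_spec
    simp only [Inst.Useful.toFooted, RTree.vars]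
    rw [List.map_flatten, List.map_ofFn, List.nodup_flatten]
    refine ⟨?_, ?_⟩
    · intro l hl
      obtain ⟨j, rfl⟩ := List.mem_ofFn.1 hl
      simp
    · rw [List.pairwise_ofFn]
      intro j j' hjj i hi hi'
      simp only [Function.comp_apply, List.map_cons, List.map_nil, List.mem_singleton] at hi hi'
      refine hjj.ne (G.footedGrammar.linkOrder_get_injective hI.rule ?_)
      rw [← (Inst.exists_arg _ (ρ := hI.rule) rfl j).choose_spec,
        ← (Inst.exists_arg _ (ρ := hI.rule) rfl j').choose_spec, ← hi, ← hi']
  deterministic := by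
    rintro _ ρ _ ⟨x, rfl⟩ _ ⟨x', rfl⟩ hne
    obtain ⟨i, hi⟩ : ∃ i, x.1 i ≠ x'.1 i := by
      by_contra hc
      push Not at hc
      obtain rfl : x = x' := Subtype.ext (funext hc)
      exact hne rfl
    exact Or.inr ⟨i, Set.disjoint_left.2 fun d hd hd' => hi (HasKey.unique hd hd')⟩

/-- A derivation tree with a reachable key is translated into one of the footed grammar whose value
consists of the pieces of its value. -/
theorem toFooted_trans {κ : G.Key} {d : GTree G.ruleRank} (h : G.HasKey κ d) (hr : G.Reach κ) :
    ∃ d', G.toFooted.Trans () d d' ∧ G.footedGrammar.derGrammar.Gen ⟨κ.names, hr.mem_big⟩ d' ∧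
      κ.Fits (G.footedGrammar.val d') ∧ G.val d = κ.assemble (G.footedGrammar.val d') := by
  classical
  induction h with
  | node I ds hds ih =>
    have hI : I.Useful := ⟨hr, fun i => ⟨_, hds i⟩⟩
    choose sel hsel using Inst.exists_arg I (ρ := hI.rule) rfl
    have hsel' : ∀ j, (I.exists_arg (ρ := hI.rule) rfl j).choose = sel j := fun j =>
      Inst.arg_injective (I := I) (by
        have h1 := (I.exists_arg (ρ := hI.rule) rfl j).choose_spec
        refine Key.eq_of_names_eq (h1.trans (hsel j).symm) ?_
        rw [h1]
        exact G.footedGrammar.big_ne_nil _ ((G.footedGrammar.rules_wf _ hI.rule.2).links_subset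
          ((G.footedGrammar.mem_linkOrder _ hI.rule.2 _).1 (List.get_mem _ j))))
    have hne : ∀ j, (I.arg (sel j)).names ≠ [] := fun j => by
      rw [hsel j]
      exact G.footedGrammar.big_ne_nil _ ((G.footedGrammar.rules_wf _ hI.rule.2).links_subset
        ((G.footedGrammar.mem_linkOrder _ hI.rule.2 _).1 (List.get_mem _ j)))
    choose f hf1 hf2 hf3 hf4 using ih
    have hreach := fun j => hI.reach_arg _ (hne j)
    have hv := I.val_eq (ρ := hI.rule) rfl (ds := ds) (ds' := fun j => f (sel j) (hreach j)) hds
      fun i j hij => by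
        obtain rfl : sel j = i := Inst.arg_injective (I := I)
          (Key.eq_of_names_eq ((hsel j).trans hij) (hne j))
        exact ⟨hf3 _ (hreach j), hf4 _ (hreach j)⟩
    refine ⟨RTree.node hI.rule fun j => f (sel j) (hreach j), ?_, ?_, hv⟩
    · have ht := LDTR.Trans.step (M := G.toFooted) () I.rule ds hI.toFooted
        -- The transducer visits only subtrees with reachable keys; the other values are irrelevant.
        (fun x => if h : G.Reach (I.arg x.2) then f x.2 h
          else RTree.node hI.rule fun j => f (sel j) (hreach j))
        ⟨⟨I.arg, I.arg_big, hI⟩, rfl⟩ trivial hds fun x hx => by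
          simp only [Inst.Useful.toFooted] at hx
          obtain ⟨j, hj⟩ := RTree.mem_vars_node.1 hx
          obtain rfl := List.mem_singleton.1 hj
          simp only [hsel', dif_pos (hreach j)]
          exact hf1 _ (hreach j)
      convert ht using 1
      simp only [Inst.Useful.toFooted, RTree.bind, hsel', dif_pos (hreach _)]
    · exact RTG.Gen.node (H := G.footedGrammar.derGrammar) _ hI.rule
        (fun j => ⟨(I.arg (sel j)).names, (hreach j).mem_big⟩) _ ⟨rfl, hsel⟩
        fun j => hf2 _ (hreach j)

/-! ### The transducer from the footed grammar -/

/-- An instance that gives rise to a rule of the footed grammar. Different instances may give rise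
to the same rule if links are omitted, so that a choice is necessary. -/
noncomputable def someInst (ρ : G.footedGrammar.Rules) : G.Inst :=
  (mem_rules_footedGrammar.1 ρ.2).choose

theorem useful_someInst (ρ : G.footedGrammar.Rules) : (someInst ρ).Useful :=
  (mem_rules_footedGrammar.1 ρ.2).choose_spec.1

theorem toRule_someInst (ρ : G.footedGrammar.Rules) : ρ.1 = (someInst ρ).toRule :=
  (mem_rules_footedGrammar.1 ρ.2).choose_spec.2.symm

open Classical in
/-- The transducer rule that outputs the rule of an instance, with a fixed derivation tree for each
link whose key has no pieces. -/
noncomputable def ofFootedRule (ρ : G.footedGrammar.Rules) :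
    LDTRRule G.footedGrammar.ruleRank G.ruleRank Unit ρ where
  look0 := Set.univ
  look _ := Set.univ
  out := RTree.node (someInst ρ).rule fun i =>
    if h : ((someInst ρ).arg i).names = [] then
      ((useful_someInst ρ).hasKey i).choose.bind fun e => e.elim
    else RTree.var ((), ((someInst ρ).exists_link (toRule_someInst ρ) i h).choose)

/-- The relabelling of the derivation trees of the footed grammar by the underlying rules. -/
noncomputable def ofFooted (G : MCFTG.{u, v} rkT) : LDTR G.footedGrammar.ruleRank G.ruleRank where
  Q := Unit
  finite_Q := inferInstance
  q0 := ()
  rules _ ρ := {ofFootedRule ρ}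
  finite_rules _ _ := Set.finite_singleton _
  regular_look0 := by
    rintro _ ρ _ rfl
    exact isRegularTreeLanguage_univ
  regular_look := by
    rintro _ ρ _ rfl i
    exact isRegularTreeLanguage_univ
  linear := by
    classical
    rintro _ ρ _ rfl
    have hvars : ∀ i, ∀ x ∈ (if h : ((someInst ρ).arg i).names = [] then
        ((useful_someInst ρ).hasKey i).choose.bind fun e => e.elim
        else RTree.var ((), ((someInst ρ).exists_link (toRule_someInst ρ) i h).choose) :
          RTree G.ruleRank (Unit × Fin (G.footedGrammar.ruleRank ρ))).vars,
        (G.footedGrammar.linkOrder ρ.1).get x.2 = ((someInst ρ).arg i).names ∧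
          ((someInst ρ).arg i).names ≠ [] := by
      intro i x hx
      split_ifs at hx with h
      · rw [RTree.vars_bind] at hx
        obtain ⟨e, _⟩ := List.mem_flatMap.1 hx
        exact e.elim
      · rw [RTree.vars, List.mem_singleton] at hx
        subst hx
        exact ⟨((someInst ρ).exists_link (toRule_someInst ρ) i h).choose_spec, h⟩
    simp only [ofFootedRule, RTree.vars]
    rw [List.map_flatten, List.map_ofFn, List.nodup_flatten]
    refine ⟨?_, ?_⟩
    · intro l hl
      obtain ⟨i, rfl⟩ := List.mem_ofFn.1 hl
      simp only [Function.comp_apply]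
      split_ifs with h
      · rw [RTree.vars_bind, show RTree.vars _ = [] from
          List.eq_nil_iff_forall_not_mem.2 fun e => e.elim]
        simp
      · simp [RTree.vars]
    · rw [List.pairwise_ofFn]
      intro i i' hii j hj hj'
      obtain ⟨x, hx, rfl⟩ := List.mem_map.1 hj
      obtain ⟨y, hy, hyx⟩ := List.mem_map.1 hj'
      obtain ⟨h1, h2⟩ := hvars i x hx
      obtain ⟨h3, _⟩ := hvars i' y hy
      rw [hyx, h1] at h3
      exact hii.ne (Inst.arg_injective (Key.eq_of_names_eq h3 h2))
  deterministic := by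
    rintro _ ρ _ rfl _ rfl h
    exact (h rfl).elim

/-- Every derivation tree of the footed grammar is translated into one of `G` whose value consists
of the shapes of its key, filled with the pieces. -/
theorem ofFooted_trans {A : G.footedGrammar.derGrammar.NT} {d' : GTree G.footedGrammar.ruleRank}
    (h : G.footedGrammar.derGrammar.Gen A d') :
    ∃ κ d, κ.names = A.1 ∧ G.ofFooted.Trans () d' d ∧ G.HasKey κ d ∧
      κ.Fits (G.footedGrammar.val d') ∧ G.val d = κ.assemble (G.footedGrammar.val d') := by
  classical
  induction h with
  | node A ρ Bs ds' hr _ ih =>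
    choose κs f hκs hf1 hf2 hf3 hf4 using ih
    have hρ := toRule_someInst ρ
    have hU := useful_someInst ρ
    let link : ∀ i, ((someInst ρ).arg i).names ≠ [] → Fin (G.footedGrammar.ruleRank ρ) :=
      fun i h => ((someInst ρ).exists_link hρ i h).choose
    have hlink : ∀ i h, (G.footedGrammar.linkOrder ρ.1).get (link i h) =
        ((someInst ρ).arg i).names := fun i h => ((someInst ρ).exists_link hρ i h).choose_spec
    let ds : Fin (G.ruleRank (someInst ρ).rule) → GTree G.ruleRank := fun i =>
      if h : ((someInst ρ).arg i).names = [] then (hU.hasKey i).choose else f (link i h)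
    have hκ : ∀ i j, (G.footedGrammar.linkOrder ρ.1).get j = ((someInst ρ).arg i).names →
        κs j = (someInst ρ).arg i := by
      intro i j hij
      have h1 : (κs j).names = ((someInst ρ).arg i).names :=
        ((hκs j).trans (hr.2 j)).trans hij
      exact Key.eq_of_names_eq h1 (hκs j ▸ G.footedGrammar.big_ne_nil _ (Bs j).2)
    have hds : ∀ i, G.HasKey ((someInst ρ).arg i) (ds i) := by
      intro i
      by_cases h : ((someInst ρ).arg i).names = []
      · simp only [ds, dif_pos h]
        exact (hU.hasKey i).choose_spec
      · simp only [ds, dif_neg h]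
        rw [← hκ i _ (hlink i h)]
        exact hf2 _
    have hv := (someInst ρ).val_eq (ds' := ds') hρ hds fun i j hij => by
      have hk := hκ i j hij
      have hne : ((someInst ρ).arg i).names ≠ [] := by
        rw [← hk, hκs j]
        exact G.footedGrammar.big_ne_nil _ (Bs j).2
      obtain rfl : link i hne = j :=
        G.footedGrammar.linkOrder_get_injective ρ ((hlink i hne).trans hij.symm)
      simp only [ds, dif_neg hne]
      rw [← hk]
      exact ⟨hf3 _, hf4 _⟩
    refine ⟨(someInst ρ).head, RTree.node (someInst ρ).rule ds, ?_, ?_, HasKey.node _ ds hds, hv⟩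
    · rw [← hr.1, hρ]
      rfl
    · have ht := LDTR.Trans.step (M := G.ofFooted) () ρ ds' (ofFootedRule ρ) (fun x => f x.2)
        rfl trivial (fun _ => trivial) fun x _ => hf1 x.2
      convert ht using 1
      simp only [ofFootedRule, RTree.bind]
      congr 1
      funext i
      by_cases h : ((someInst ρ).arg i).names = []
      · simp only [ds, dif_pos h]
        exact ((RTree.bind_bind _ _ _).trans (RTree.bind_empty _ _)).symm
      · simp only [ds, dif_neg h]
        rfl

theorem ldtrEquivalent_footedGrammar : G.LDTREquivalent G.footedGrammar := by
  refine ⟨G.toFooted, G.ofFooted, fun d hd => ?_, fun d' hd' => ?_⟩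
  · obtain ⟨κ, hκ, hS⟩ := exists_hasKey hd
    obtain rfl := eq_startKey hS
    obtain ⟨d', h1, h2, h3, h4⟩ := toFooted_trans hκ Reach.start
    refine ⟨d', h1, ?_, ?_⟩
    · simp only [names_startKey] at h2
      exact h2
    · rw [h4, assemble_startKey h3]
  · obtain ⟨κ, d, h0, h1, h2, h3, h4⟩ := ofFooted_trans hd'
    obtain rfl : κ = G.startKey :=
      Key.eq_of_names_eq (h0.trans names_startKey.symm) (by
        rw [h0]
        exact List.cons_ne_nil _ _)
    exact ⟨d, h1, h2.gen, by rw [h4, assemble_startKey h3]⟩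

theorem reduced_footedGrammar : G.footedGrammar.Reduced := by
  intro A hA hne
  obtain ⟨κ, hκ, rfl⟩ := mem_big_footedGrammar.1 hA
  constructor
  · clear hA hne
    induction hκ with
    | start =>
      rw [names_startKey]
      exact Relation.ReflTransGen.refl
    | step I i hI hd hi ih =>
      exact ih.tail ⟨I.toRule, mem_rules_footedGrammar.2 ⟨I, ⟨hI, hd⟩, rfl⟩, rfl,
        I.mem_links_toRule.2 ⟨⟨i, rfl⟩, hi⟩⟩
  · rcases hκ.eq_or_exists with rfl | ⟨d, hd⟩
    · exact (hne names_startKey).elim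
    · obtain ⟨d', _, h, _⟩ := toFooted_trans hd hκ
      exact ⟨_, gen_val h⟩

end MCFTG

theorem mainTheorem3 {T : Type v} [Fintype T] (rkT : T → ℕ) (G : MCFTG.{u, v} rkT)
    (hwid : 1 ≤ G.width) :
    ∃ G' : MCFTG.{u, v} rkT,
      G'.Footed ∧
      G.LDTREquivalent G' ∧
      G'.multiplicity ≤ G.multiplicity * maxRank rkT * (2 * G.width - 1) ∧
      (∀ Δ : Set T, G.Lexicalized Δ → G'.Lexicalized Δ) ∧
      G'.Reduced ∧
      (G.StartSeparated → G'.StartSeparated) :=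
  ⟨G.footedGrammar, MCFTG.footed_footedGrammar, MCFTG.ldtrEquivalent_footedGrammar,
    MCFTG.multiplicity_footedGrammar_le.trans (G.maxPieces_le hwid),
    fun _ h => MCFTG.lexicalized_footedGrammar h, MCFTG.reduced_footedGrammar,
    fun h => MCFTG.startSeparated_footedGrammar h⟩
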